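/- Let $F$ be a number field with ring of integers $\mathcal{O}_F$, adele ring $\mathbb{A}=F_\infty\times\mathbb{A}_{\mathrm{fin}}$ and class number $h$; let $G=GL_2$ with centre $Z$, and write $a(y)=\begin{pmatrix}y&0\\0&1\end{pmatrix}$, $n(x)=\begin{pmatrix}1&x\\0&1\end{pmatrix}$, $\omega=\begin{pmatrix}0&1\\-1&0\end{pmatrix}$. Put $|y|_\infty=\prod_\nu|y_\nu|^{[F_\nu:\mathbb{R}]}$ for $y\in F_\infty$. For each prime $\mathfrak{p}$ let $\mathfrak{o}_\mathfrak{p}\subset F_\mathfrak{p}$ be the local ring of integers and fix a uniformizer $\varpi_\mathfrak{p}$. Fix finite ideles $\theta_1,\dots,\theta_h\in\widehat{\mathcal{O}}_F\cap\mathbb{A}_{\mathrm{fin}}^\times$ whose ideals $\prod_\mathfrak{p}\mathfrak{p}^{v_\mathfrak{p}(\theta_i)}$ represent each ideal class exactly once. Let $K_\nu=O_2(\mathbb{R})$ or $U_2(\mathbb{C})$ for real resp. complex $\nu$, and $K_\mathfrak{p}=GL_2(\mathfrak{o}_\mathfrak{p})$. Let $K_{0,\mathfrak{p}}(m)$ be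 the set of elements of $K_\mathfrak{p}$ with lower left entry in $\varpi_\mathfrak{p}^m\mathfrak{o}_\mathfrak{p}$, and $K_{1,\mathfrak{p}}(m)$ the set of those elements of $K_{0,\mathfrak{p}}(m)$ whose upper left entry lies in $1+\varpi_\mathfrak{p}^m\mathfrak{o}_\mathfrak{p}$. Let $\mathfrak{n}$ be a nonzero ideal of $\mathcal{O}_F$, $n_\mathfrak{p}=v_\mathfrak{p}(\mathfrak{n})$, $n_{1,\mathfrak{p}}=\lceil n_\mathfrak{p}/2\rceil$, $n_{0,\mathfrak{p}}=n_\mathfrak{p}-n_{1,\mathfrak{p}}$, $\mathfrak{n}_2=\prod_\mathfrak{p}\mathfrak{p}^{n_{1,\mathfrak{p}}-n_{0,\mathfrak{p}}}$, and $K_1(\mathfrak{n})=\prod_\nu K_\nu\prod_\mathfrak{p}K_{1,\mathfrak{p}}(n_\mathfrak{p})$. * For $g\in G(F_\mathfrak{p})$ let $l_\mathfrak{p}(g)$ be the unique $l\in\{0,\dots,n_\mathfrak{p}\}$ such that $g\in Z(F_\mathfrak{p})\,n(x)\,a(\varpi_\mathfrak{p}^t)\,\omega\, n(\varpi_\mathfrak{p}^{-l}v)K_{1,\mathfrak{p}}(n_\mathfrak{p})$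 for some $x\in F_\mathfrak{p}$, $t\in\mathbb{Z}$, $v\in\mathfrak{o}_\mathfrak{p}^\times$. Put $n_{1,\mathfrak{p}}(g)=n_{0,\mathfrak{p}}$ if $l_\mathfrak{p}(g)\le n_{0,\mathfrak{p}}$, and $n_{1,\mathfrak{p}}(g)=n_{1,\mathfrak{p}}$ otherwise. Let $\mathcal{J}_\mathfrak{n}\subset G(\mathbb{A}_{\mathrm{fin}})$ be the set of $g$ such that $g_\mathfrak{p}\in K_\mathfrak{p}a(\varpi_\mathfrak{p}^{n_{1,\mathfrak{p}}})$ and $n_{1,\mathfrak{p}}(g_\mathfrak{p})=n_{0,\mathfrak{p}}$ for $\mathfrak{p}\mid\mathfrak{n}$, and $g_\mathfrak{p}=1$ for $\mathfrak{p}\nmid\mathfrak{n}$. * For an ideal $\mathfrak{L}$ let $\eta_\mathfrak{L}\in G(\mathbb{A})$ have component $\begin{pmatrix}0&1\\ \varpi_\mathfrak{p}^{n_\mathfrak{p}}&0\end{pmatrix}$ at $\mathfrak{p}\mid\mathfrak{L}$ and $1$ at all other places. * Let $K^*=\prod_\nu Z(F_\nu)K_\nu\prod_{\mathfrak{p}\nmid\mathfrak{n}_2}Z(F_\mathfrak{p})K_\mathfrak{p}\prod_{\mathfrak{p}\mid\mathfrak{n}_2}\left\langle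 K_{0,\mathfrak{p}}(1),\begin{pmatrix}0&1\\ \varpi_\mathfrak{p}&0\end{pmatrix}\right\rangle$ (inside $G(\mathbb{A})$). A special matrix is an element $\begin{pmatrix}y&x\\0&1\end{pmatrix}a(\theta_i)$ with $y\in F_\infty^\times$, $x\in F_\infty$, $1\le i\le h$. Let $\mathcal{F}(\mathfrak{n}_2)$ be the set of special matrices for which $|y|_\infty$ is maximal among all special matrices in the same double coset in $G(F)\backslash G(\mathbb{A})/K^*$, and let $\mathcal{F}_{\mathfrak{n}_2}\subset G(F_\infty)$ be the set of all $\begin{pmatrix}y&x\\0&1\end{pmatrix}$ such that $\begin{pmatrix}y&x\\0&1\end{pmatrix}a(\theta_i)\in\mathcal{F}(\mathfrak{n}_2)$ for some $i$. Then the following hold. (1) For every $g\in G(\mathbb{A})$ there are an ideal $\mathfrak{L}\mid\mathfrak{n}_2$ and $1\le i\le h$ such that $$g\in Z(\mathbb{A})\,G(F)\,\bigl(a(\theta_i)\mathcal{J}_\mathfrak{n}\times\mathcal{F}_{\mathfrak{n}_2}\bigr)\,\eta_\mathfrak{L}\,K_1(\mathfrak{n}).$$ (2) Let $\varphi\colon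 G(\mathbb{A})\to\mathbb{C}$ be left $G(F)$-invariant and right $K_1(\mathfrak{n})$-invariant, and suppose that $\varphi(zg)=\omega_\varphi(z)\varphi(g)$ for all $z\in Z(\mathbb{A})=\mathbb{A}^\times$, with a unitary character $\omega_\varphi$ of $\mathbb{A}^\times$ (for instance, let $\varphi$ be the newform of a cuspidal automorphic representation of conductor $\mathfrak{n}$ with unitary central character $\omega_\varphi$ that is spherical at the archimedean places). For every $\mathfrak{L}\mid\mathfrak{n}_2$ let $\omega^\mathfrak{L}$ be a unitary character of $\mathbb{A}^\times$ which is trivial on $\prod_{\mathfrak{p}\mid\mathfrak{L}}\mathfrak{o}_\mathfrak{p}^\times$ and agrees with $\omega_\varphi$ on $\prod_{\mathfrak{p}\nmid\mathfrak{L}}\mathfrak{o}_\mathfrak{p}^\times$, and put $\varphi^\mathfrak{L}(g)=\omega_\varphi^{-1}\omega^\mathfrak{L}(\det g)\,\varphi(g\eta_\mathfrak{L})$. Then, in $[0,\infty]$, $$\sup_{g\in G(\mathbb{A})}|\varphi(g)|\le\sup_{\mathfrak{L}\mid\mathfrak{n}_2}\ \sup_{1\le i\le h}\ \sup_{g\in\mathcal{J}_\mathfrak{n}\times\mathcal{F}_{\mathfrak{n}_2}}\bigl|\varphi^\mathfrak{L}(a(\theta_i)g)\bigr|.$$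 -/

import Mathlib

open NumberField IsDedekindDomain Matrix
open scoped MatrixGroups nonZeroDivisors

namespace AdelicGL2

noncomputable section

/-! ### Elementary matrices over a commutative ring -/

section Ring

variable {R : Type*} [CommRing R]

/-- The matrix `a(y) = (y 0; 0 1)`. -/
def aMat (y : Rˣ) : GL (Fin 2) R where
  val := !![(y : R), 0; 0, 1]
  inv := !![((y⁻¹ : Rˣ) : R), 0; 0, 1]
  val_inv := by ext i j; fin_cases i <;> fin_cases j <;> simp [Matrix.mul_apply]
  inv_val := by ext i j; fin_cases i <;> fin_cases j <;> simp [Matrix.mul_apply]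

/-- The matrix `n(x) = (1 x; 0 1)`. -/
def nMat (x : R) : GL (Fin 2) R where
  val := !![1, x; 0, 1]
  inv := !![1, -x; 0, 1]
  val_inv := by ext i j; fin_cases i <;> fin_cases j <;> simp [Matrix.mul_apply]
  inv_val := by ext i j; fin_cases i <;> fin_cases j <;> simp [Matrix.mul_apply]

/-- The matrix `(0 1; u 0)`. -/
def antiMat (u : Rˣ) : GL (Fin 2) R where
  val := !![0, 1; (u : R), 0]
  inv := !![0, ((u⁻¹ : Rˣ) : R); 1, 0]
  val_inv := by ext i j; fin_cases i <;> fin_cases j <;> simp [Matrix.mul_apply]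
  inv_val := by ext i j; fin_cases i <;> fin_cases j <;> simp [Matrix.mul_apply]

/-- The long Weyl element `ω = (0 1; -1 0)`. -/
def weyl : GL (Fin 2) R := antiMat (-1)

/-- The scalar matrix `z(r)`. -/
def zMat (r : Rˣ) : GL (Fin 2) R := Matrix.GeneralLinearGroup.scalar (Fin 2) r

/-- The matrix `(y x; 0 1) = n(x) a(y)`. -/
def bMat (y : Rˣ) (x : R) : GL (Fin 2) R := nMat x * aMat y

end Ring

variable {F : Type*} [Field F] [NumberField F]

/-! ### Exponents of ideals -/

/-- `n_𝔭 = v_𝔭(𝔫)`, the exponent of the prime `𝔭` in the nonzero ideal `𝔫`. -/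
def ordAt (𝔫 : Ideal (𝓞 F)) (p : HeightOneSpectrum (𝓞 F)) : ℕ :=
  open Classical in (Associates.mk p.asIdeal).count (Associates.mk 𝔫).factors

/-- `n_{1,𝔭} = ⌈n_𝔭 / 2⌉`. -/
def ord1 (𝔫 : Ideal (𝓞 F)) (p : HeightOneSpectrum (𝓞 F)) : ℕ := (ordAt 𝔫 p + 1) / 2

/-- `n_{0,𝔭} = n_𝔭 - n_{1,𝔭}` (there is no truncation, as `n_{1,𝔭} ≤ n_𝔭`). -/
def ord0 (𝔫 : Ideal (𝓞 F)) (p : HeightOneSpectrum (𝓞 F)) : ℕ := ordAt 𝔫 p - ord1 𝔫 p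

/-- The square-free ideal `𝔫₂ = ∏ 𝔭 ^ (n_{1,𝔭} - n_{0,𝔭})`. -/
def sqfreePart (𝔫 : Ideal (𝓞 F)) : Ideal (𝓞 F) :=
  ∏ᶠ p : HeightOneSpectrum (𝓞 F), p.asIdeal ^ (ord1 𝔫 p - ord0 𝔫 p)

theorem ordAt_eventually_eq_zero (𝔫 : Ideal (𝓞 F)) :
    ∀ᶠ p : HeightOneSpectrum (𝓞 F) in Filter.cofinite, ordAt 𝔫 p = 0 := by
  classical
  by_cases h : 𝔫 = 0
  · subst h
    exact Filter.Eventually.of_forall fun p => by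
      unfold ordAt
      rw [Associates.mk_zero, Associates.factors_zero]
      rw [Associates.count, dif_pos p.associates_irreducible]
      rfl
  · filter_upwards [Associates.finite_factors h] with p hp
    unfold ordAt
    exact_mod_cast hp

/-! ### Adeles and their components -/

/-- The adele ring `𝔸_F = F_∞ × 𝔸_fin`. -/
abbrev Adele (F : Type*) [Field F] [NumberField F] := AdeleRing (𝓞 F) F

/-- The ring of finite adeles. -/
abbrev FinAdele (F : Type*) [Field F] [NumberField F] := FiniteAdeleRing (𝓞 F) F

/-- The projection of `𝔸_fin` to `F_𝔭`. -/
def evalFin (p : HeightOneSpectrum (𝓞 F)) : FinAdele F →+* p.adicCompletion F where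
  toFun a := a p
  map_one' := rfl
  map_mul' _ _ := rfl
  map_zero' := rfl
  map_add' _ _ := rfl

/-- The projection of `𝔸_F` to `𝔸_fin`. -/
def projFin : Adele F →+* FinAdele F where
  toFun a := a.2
  map_one' := rfl
  map_mul' _ _ := rfl
  map_zero' := rfl
  map_add' _ _ := rfl

/-- The projection of `𝔸_F` to `F_ν`, `ν` archimedean. -/
def evalInf (v : InfinitePlace F) : Adele F →+* v.Completion where
  toFun a := a.1 v
  map_one' := rfl
  map_mul' _ _ := rfl
  map_zero' := rfl
  map_add' _ _ := rfl

/-- The `𝔭`-component of an element of `GL₂(𝔸_fin)`. -/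
def compFin (p : HeightOneSpectrum (𝓞 F)) : GL (Fin 2) (FinAdele F) →* GL (Fin 2) (p.adicCompletion F) :=
  Matrix.GeneralLinearGroup.map (evalFin p)

/-- The finite part of an element of `GL₂(𝔸_F)`. -/
def finPart : GL (Fin 2) (Adele F) →* GL (Fin 2) (FinAdele F) :=
  Matrix.GeneralLinearGroup.map projFin

/-- The `ν`-component of an element of `GL₂(𝔸_F)`, `ν` archimedean. -/
def compInf (v : InfinitePlace F) : GL (Fin 2) (Adele F) →* GL (Fin 2) v.Completion :=
  Matrix.GeneralLinearGroup.map (evalInf v)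

/-- The diagonal embedding `GL₂(F) → GL₂(𝔸_F)`. -/
def rational : GL (Fin 2) F →* GL (Fin 2) (Adele F) :=
  Matrix.GeneralLinearGroup.map (algebraMap F (Adele F))

/-- The element of `GL₂(𝔸_F) = GL₂(F_∞) × GL₂(𝔸_fin)` with the given two components. -/
def glPair (b : GL (Fin 2) (InfiniteAdeleRing F)) (g : GL (Fin 2) (FinAdele F)) :
    GL (Fin 2) (Adele F) where
  val := Matrix.of fun i j => (b.val i j, g.val i j)
  inv := Matrix.of fun i j => (b⁻¹.val i j, g⁻¹.val i j)
  val_inv := by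
    ext i j
    have hb := congrFun (congrFun b.val_inv i) j
    have hg := congrFun (congrFun g.val_inv i) j
    rw [Matrix.mul_apply, Fin.sum_univ_two] at hb hg ⊢
    refine Prod.ext (hb.trans ?_) (hg.trans ?_) <;> fin_cases i <;> fin_cases j <;> rfl
  inv_val := by
    ext i j
    have hb := congrFun (congrFun b.inv_val i) j
    have hg := congrFun (congrFun g.inv_val i) j
    rw [Matrix.mul_apply, Fin.sum_univ_two] at hb hg ⊢
    refine Prod.ext (hb.trans ?_) (hg.trans ?_) <;> fin_cases i <;> fin_cases j <;> rfl

/-! ### Local compact groups -/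

/-- `K_ν`: `O₂(ℝ)` at a real place and `U₂(ℂ)` at a complex place. At a real place the embedding
`F_ν → ℂ` has real values, so that the unitary matrices in its image are the orthogonal ones. -/
def KInf (v : InfinitePlace F) : Set (GL (Fin 2) v.Completion) :=
  {g | g.val.map (InfinitePlace.Completion.extensionEmbedding v) ∈ Matrix.unitaryGroup (Fin 2) ℂ}

/-- `K_𝔭 = GL₂(𝔬_𝔭)`. -/
def KFin (p : HeightOneSpectrum (𝓞 F)) : Subgroup (GL (Fin 2) (p.adicCompletion F)) :=
  (Matrix.GeneralLinearGroup.map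
    (algebraMap (p.adicCompletionIntegers F) (p.adicCompletion F))).range

/-- `K_{0,𝔭}(n)`: the lower left entry lies in `ϖ_𝔭 ^ n 𝔬_𝔭`. -/
def K0Fin (p : HeightOneSpectrum (𝓞 F)) (n : ℕ) : Set (GL (Fin 2) (p.adicCompletion F)) :=
  {g | g ∈ KFin p ∧ Valued.v (g.val 1 0) ≤ WithZero.exp (-(n : ℤ))}

/-- `K_{1,𝔭}(n)`: moreover the upper left entry lies in `1 + ϖ_𝔭 ^ n 𝔬_𝔭`. -/
def K1Fin (p : HeightOneSpectrum (𝓞 F)) (n : ℕ) : Set (GL (Fin 2) (p.adicCompletion F)) :=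
  {g | g ∈ KFin p ∧ Valued.v (g.val 0 0 - 1) ≤ WithZero.exp (-(n : ℤ)) ∧
    Valued.v (g.val 1 0) ≤ WithZero.exp (-(n : ℤ))}

/-- `K₁(𝔫) = K_∞ ∏ K_{1,𝔭}(v_𝔭(𝔫))`. -/
def K1 (𝔫 : Ideal (𝓞 F)) : Set (GL (Fin 2) (Adele F)) :=
  {g | (∀ v, compInf v g ∈ KInf v) ∧ ∀ p, compFin p (finPart g) ∈ K1Fin p (ordAt 𝔫 p)}

/-! ### Uniformizers and class group representatives -/

/-- A choice of a uniformizer `ϖ_𝔭` of `F_𝔭` for every `𝔭`. -/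
def Uniformizers (F : Type*) [Field F] [NumberField F] :=
  ∀ p : HeightOneSpectrum (𝓞 F), {x : p.adicCompletion F // Valued.v x = WithZero.exp (-1 : ℤ)}

/-- The uniformizer `ϖ_𝔭` as an element of `F_𝔭ˣ`. -/
def Uniformizers.unit (ϖ : Uniformizers F) (p : HeightOneSpectrum (𝓞 F)) : (p.adicCompletion F)ˣ :=
  Units.mk0 (ϖ p).1 (by
    intro h
    have := (ϖ p).2
    rw [h, map_zero] at this
    exact WithZero.exp_ne_zero this.symm)

/-- `θ_1, …, θ_h` are finite ideles that lie in `𝒪̂_F` and whose ideals `∏ 𝔭 ^ v_𝔭(θ_i)` represent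
every ideal class exactly once. -/
structure IsClassRepresentatives (θ : Fin (NumberField.classNumber F) → (FinAdele F)ˣ) : Prop where
  integral : ∀ i p, Valued.v ((θ i : FinAdele F) p) ≤ 1
  existsUnique : ∀ C : ClassGroup (𝓞 F), ∃! i, ∃ I : (Ideal (𝓞 F))⁰,
    (∀ p, Valued.v ((θ i : FinAdele F) p) = WithZero.exp (-(ordAt I.1 p : ℤ))) ∧
      ClassGroup.mk0 I = C

/-! ### The set `𝒥` -/

/-- The set `⋃_{t, v} Z(F_𝔭) N(F_𝔭) a(ϖ ^ t) ω n(ϖ ^ (-l) v) K_{1,𝔭}(n)`, with `t` in `ℤ` and `v` in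
`𝔬_𝔭ˣ`. For `0 ≤ l ≤ n` these sets partition `GL₂(F_𝔭)`. -/
def localCell (ϖ : Uniformizers F) (p : HeightOneSpectrum (𝓞 F)) (n l : ℕ) :
    Set (GL (Fin 2) (p.adicCompletion F)) :=
  {g | ∃ (z : (p.adicCompletion F)ˣ) (x : p.adicCompletion F) (t : ℤ) (v : p.adicCompletion F),
    Valued.v v = 1 ∧ ∃ k ∈ K1Fin p n,
      g = zMat z * nMat x * (aMat (ϖ.unit p ^ t) * weyl *
        nMat (((ϖ.unit p ^ (-(l : ℤ)) : (p.adicCompletion F)ˣ) : p.adicCompletion F) * v)) * k}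

/-- The invariant `l_𝔭(g)`: the unique `l` with `0 ≤ l ≤ n` such that `g` lies in the `l`-th cell. -/
def lInv (ϖ : Uniformizers F) (p : HeightOneSpectrum (𝓞 F)) (n : ℕ)
    (g : GL (Fin 2) (p.adicCompletion F)) : ℕ :=
  sInf {l | l ≤ n ∧ g ∈ localCell ϖ p n l}

/-- The invariant `n_{1,𝔭}(g)`, equal to `n_{0,𝔭}` if `l_𝔭(g) ≤ n_{0,𝔭}` and to `n_{1,𝔭}` if
`l_𝔭(g) ≥ n_{1,𝔭}`; since `n_{1,𝔭} ≤ n_{0,𝔭} + 1`, this covers all cases. -/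
def n1Inv (ϖ : Uniformizers F) (𝔫 : Ideal (𝓞 F)) (p : HeightOneSpectrum (𝓞 F))
    (g : GL (Fin 2) (p.adicCompletion F)) : ℕ :=
  if lInv ϖ p (ordAt 𝔫 p) g ≤ ord0 𝔫 p then ord0 𝔫 p else ord1 𝔫 p

/-- `J_𝔏 = K_𝔏 h_𝔏` inside `GL₂(𝔸_fin)`: the component at `𝔭 ∣ 𝔏` lies in
`K_𝔭 a(ϖ_𝔭 ^ n_{1,𝔭})`, the component at `𝔭 ∤ 𝔏` is `1`. -/
def bigJ (ϖ : Uniformizers F) (𝔫 𝔏 : Ideal (𝓞 F)) : Set (GL (Fin 2) (FinAdele F)) :=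
  {g | (∀ p : HeightOneSpectrum (𝓞 F), p.asIdeal ∣ 𝔏 →
      ∃ k ∈ KFin p, compFin p g = k * aMat (ϖ.unit p ^ ord1 𝔫 p)) ∧
    ∀ p : HeightOneSpectrum (𝓞 F), ¬ p.asIdeal ∣ 𝔏 → compFin p g = 1}

/-- `𝒥_𝔏 = {g ∈ J_𝔏 : n_{1,𝔭}(g_𝔭) = n_{0,𝔭} for all 𝔭 ∣ 𝔏}`. -/
def calJ (ϖ : Uniformizers F) (𝔫 𝔏 : Ideal (𝓞 F)) : Set (GL (Fin 2) (FinAdele F)) :=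
  {g | g ∈ bigJ ϖ 𝔫 𝔏 ∧ ∀ p : HeightOneSpectrum (𝓞 F), p.asIdeal ∣ 𝔏 →
    n1Inv ϖ 𝔫 p (compFin p g) = ord0 𝔫 p}

/-! ### The matrices `η_𝔏` -/

theorem valued_le_one_of_mem_KFin {p : HeightOneSpectrum (𝓞 F)}
    {g : GL (Fin 2) (p.adicCompletion F)} (hg : g ∈ KFin p) (i j : Fin 2) :
    g.val i j ∈ p.adicCompletionIntegers F := by
  obtain ⟨k, rfl⟩ := hg
  exact (k.val i j).2

/-- The element of `GL₂(𝔸_fin)` with given components, almost all of which lie in `K_𝔭`. -/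
def finOfLocal (g : ∀ p : HeightOneSpectrum (𝓞 F), GL (Fin 2) (p.adicCompletion F))
    (h : ∀ᶠ p in Filter.cofinite, g p ∈ KFin p) : GL (Fin 2) (FinAdele F) where
  val := Matrix.of fun i j =>
    ⟨fun p => (g p).val i j, h.mono fun _ hp => valued_le_one_of_mem_KFin hp i j⟩
  inv := Matrix.of fun i j =>
    ⟨fun p => (g p)⁻¹.val i j, h.mono fun _ hp => valued_le_one_of_mem_KFin (inv_mem hp) i j⟩
  val_inv := by
    ext i j : 1
    refine FiniteAdeleRing.ext _ fun p => ?_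
    have hg := congrFun (congrFun (g p).val_inv i) j
    rw [Matrix.mul_apply, Fin.sum_univ_two] at hg ⊢
    refine hg.trans ?_
    fin_cases i <;> fin_cases j <;> rfl
  inv_val := by
    ext i j : 1
    refine FiniteAdeleRing.ext _ fun p => ?_
    have hg := congrFun (congrFun (g p).inv_val i) j
    rw [Matrix.mul_apply, Fin.sum_univ_two] at hg ⊢
    refine hg.trans ?_
    fin_cases i <;> fin_cases j <;> rfl

/-- The local component of `η_𝔏`: `(0 1; ϖ_𝔭 ^ n_𝔭 0)` if `𝔭 ∣ 𝔏` and `1` otherwise. -/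
def etaLocal (ϖ : Uniformizers F) (𝔫 𝔏 : Ideal (𝓞 F)) (p : HeightOneSpectrum (𝓞 F)) :
    GL (Fin 2) (p.adicCompletion F) :=
  open Classical in if p.asIdeal ∣ 𝔏 then antiMat (ϖ.unit p ^ ordAt 𝔫 p) else 1

theorem etaLocal_eventually_mem (ϖ : Uniformizers F) (𝔫 𝔏 : Ideal (𝓞 F)) :
    ∀ᶠ p in Filter.cofinite, etaLocal ϖ 𝔫 𝔏 p ∈ KFin p := by
  filter_upwards [ordAt_eventually_eq_zero 𝔫] with p hp
  unfold etaLocal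
  split_ifs
  · rw [hp, pow_zero]
    refine ⟨antiMat 1, ?_⟩
    ext i j
    fin_cases i <;> fin_cases j <;> simp [antiMat]
  · exact one_mem _

/-- The element `η_𝔏` of `GL₂(𝔸_F)`; its archimedean components are `1`. -/
def eta (ϖ : Uniformizers F) (𝔫 𝔏 : Ideal (𝓞 F)) : GL (Fin 2) (Adele F) :=
  glPair 1 (finOfLocal (etaLocal ϖ 𝔫 𝔏) (etaLocal_eventually_mem ϖ 𝔫 𝔏))

/-! ### The generating domain for square-free level -/

/-- The group `K^*` for the square-free ideal `𝔞`, with components in `Z(F_ν) K_ν` at the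
archimedean places, in `Z(F_𝔭) K_𝔭` at `𝔭 ∤ 𝔞`, and in the group generated by `K_{0,𝔭}(1)` and
`(0 1; ϖ_𝔭 0)` at `𝔭 ∣ 𝔞`. -/
def KStar (ϖ : Uniformizers F) (𝔞 : Ideal (𝓞 F)) : Set (GL (Fin 2) (Adele F)) :=
  {g | (∀ v, ∃ (z : v.Completionˣ), ∃ k ∈ KInf v, compInf v g = zMat z * k) ∧
    (∀ p : HeightOneSpectrum (𝓞 F), ¬ p.asIdeal ∣ 𝔞 →
      ∃ (z : (p.adicCompletion F)ˣ), ∃ k ∈ KFin p, compFin p (finPart g) = zMat z * k) ∧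
    ∀ p : HeightOneSpectrum (𝓞 F), p.asIdeal ∣ 𝔞 →
      compFin p (finPart g) ∈ Subgroup.closure (K0Fin p 1 ∪ {antiMat (ϖ.unit p)})}

/-- The special matrix `(y x; 0 1) a(θ_i)` with `(y x; 0 1)` in `B(F_∞)`. -/
def special (θ : Fin (NumberField.classNumber F) → (FinAdele F)ˣ)
    (y : (InfiniteAdeleRing F)ˣ) (x : InfiniteAdeleRing F)
    (i : Fin (NumberField.classNumber F)) : GL (Fin 2) (Adele F) :=
  glPair (bMat y x) (aMat (θ i))

/-- The generating domain `ℱ(𝔞)` for `GL₂(F) \ GL₂(𝔸_F) / K^*`: the special matrices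
`(y x; 0 1) a(θ_i)` for which `|y|_∞` is maximal among all special matrices in the same double
coset. The norm of Mathlib on `F_∞` is the modulus `∏_ν |y_ν| ^ [F_ν : ℝ]`. -/
def genDomain (ϖ : Uniformizers F) (θ : Fin (NumberField.classNumber F) → (FinAdele F)ˣ)
    (𝔞 : Ideal (𝓞 F)) : Set (GL (Fin 2) (Adele F)) :=
  {g | ∃ y x i, g = special θ y x i ∧ ∀ y' x' i',
    (∃ γ : GL (Fin 2) F, ∃ k ∈ KStar ϖ 𝔞, special θ y' x' i' = rational γ * g * k) →
      ‖(y' : InfiniteAdeleRing F)‖ ≤ ‖(y : InfiniteAdeleRing F)‖}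

/-- `ℱ_𝔞`: the matrices `(y x; 0 1)` in `GL₂(F_∞)` with `(y x; 0 1) a(θ_i) ∈ ℱ(𝔞)` for some `i`. -/
def calF (ϖ : Uniformizers F) (θ : Fin (NumberField.classNumber F) → (FinAdele F)ˣ)
    (𝔞 : Ideal (𝓞 F)) : Set (GL (Fin 2) (InfiniteAdeleRing F)) :=
  {b | ∃ y x, b = bMat y x ∧ ∃ i, glPair b (aMat (θ i)) ∈ genDomain ϖ θ 𝔞}

/-! ### Forms of level `𝔫` and their twists -/

/-- The transformation rules of a newform of level `𝔫` with unitary central character `ω`. -/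
structure IsFormOfLevel (φ : GL (Fin 2) (Adele F) → ℂ) (ω : (Adele F)ˣ →* Circle)
    (𝔫 : Ideal (𝓞 F)) : Prop where
  left_invariant : ∀ (γ : GL (Fin 2) F) g, φ (rational γ * g) = φ g
  central : ∀ z g, φ (zMat z * g) = (ω z : ℂ) * φ g
  right_invariant : ∀ g, ∀ k ∈ K1 𝔫, φ (g * k) = φ g

/-- `χ` is a twisting character `ω^𝔏`: on `∏ 𝔬_𝔭ˣ`, it is trivial at the places `𝔭 ∣ 𝔏` and agrees
with `ω` at the places `𝔭 ∤ 𝔏`. -/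
def IsTwistCharacter (ω : (Adele F)ˣ →* Circle) (𝔏 : Ideal (𝓞 F)) (χ : (Adele F)ˣ →* Circle) :
    Prop :=
  ∀ u : (Adele F)ˣ, (∀ v : InfinitePlace F, evalInf v (u : Adele F) = 1) →
    (∀ p : HeightOneSpectrum (𝓞 F), Valued.v (evalFin p (projFin (u : Adele F))) = 1) →
    ((∀ p : HeightOneSpectrum (𝓞 F), ¬ p.asIdeal ∣ 𝔏 →
      evalFin p (projFin (u : Adele F)) = 1) → χ u = 1) ∧
    ((∀ p : HeightOneSpectrum (𝓞 F), p.asIdeal ∣ 𝔏 →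
      evalFin p (projFin (u : Adele F)) = 1) → χ u = ω u)

/-- The twisted form `φ^𝔏(g) = ω⁻¹ω^𝔏(det g) φ(g η_𝔏)`, where `χ = ω^𝔏`. -/
def twist (ϖ : Uniformizers F) (𝔫 𝔏 : Ideal (𝓞 F)) (ω χ : (Adele F)ˣ →* Circle)
    (φ : GL (Fin 2) (Adele F) → ℂ) : GL (Fin 2) (Adele F) → ℂ :=
  fun g => (((ω (Matrix.GeneralLinearGroup.det g))⁻¹ * χ (Matrix.GeneralLinearGroup.det g) :
    Circle) : ℂ) * φ (g * eta ϖ 𝔫 𝔏)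

end

end AdelicGL2

open AdelicGL2

/-! The statement is first settled for the group K^* of square-free level 𝔫₂ and then carried to
level 𝔫 by a fixed translation. Let s be the finite matrix with component (0 1; 1 0) a(ϖ^{n₁}) at 𝔭
∣ 𝔫 and 1 elsewhere. Every double coset in G(F)\G(𝔸)/K^* meets the generating domain, so g s⁻¹ = γ σ
κ with σ in that domain and κ in K^*. It remains to factor κ s at each prime
(`exists_local_decomposition`). At 𝔭 ∣ 𝔫₂, up to the centre, κ lies in K₀(1) or in K₀(1)(0 1; ϖ 0).
For u in K₀(1) the matrix u s has lower row (u₁₁ϖ^{n₁}, u₁₀) with ϖ ∣ u₁₀, and this divisibility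
forces l ≤ n₁ - 1 = n₀ (`lInv_le`, `n1Inv_eq_ord0`). In the other coset (0 1; ϖ 0) moves to the
right of s and turns into the component of η (`antiMat_mul_antiMat_one_mul_aMat`); the primes where
this happens are the prime divisors of 𝔏. At the other divisors of 𝔫 one has n₁ = n₀, so the
condition on l is void.

That the generating domain meets every double coset has two ingredients. Special matrices exist in
each coset by strong approximation for SL₂ (`isApproximable_of_det_eq_one`), the class group and the
archimedean Iwasawa decomposition. A maximal |y|_∞ exists because, by the product formula, |y'|_∞ /
|y|_∞ at two special matrices of one coset is a ratio of idele moduli divided by a height of the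
lower row of γ and by one of finitely many factors (`norm_mul_finModulus_eq`). Bounding |y'|_∞ below
bounds that height, and Northcott's theorem leaves finitely many rows up to scaling
(`finite_norm_special`).

The inequality of suprema follows by inserting the decomposition into |φ|: the invariances of φ and
the unimodularity of the characters remove everything except the value of the twist. -/

namespace AdelicGL2

/-! ### Entries of the elementary matrices -/

section Ring

variable {R S : Type*} [CommRing R] [CommRing S]

@[simp] theorem val_aMat (y : Rˣ) : (aMat y).val = !![(y : R), 0; 0, 1] := rfl

@[simp] theorem val_nMat (x : R) : (nMat x).val = !![1, x; 0, 1] := rfl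

@[simp] theorem val_antiMat (u : Rˣ) : (antiMat u).val = !![0, 1; (u : R), 0] := rfl

theorem val_inv_antiMat (u : Rˣ) :
    (antiMat u)⁻¹.val = !![0, ((u⁻¹ : Rˣ) : R); 1, 0] := rfl

@[simp] theorem val_weyl : (weyl : GL (Fin 2) R).val = !![0, 1; -1, 0] := by
  simp [weyl]

@[simp] theorem val_zMat (r : Rˣ) : (zMat r).val = !![(r : R), 0; 0, (r : R)] := by
  ext i j
  fin_cases i <;> fin_cases j <;> simp [zMat]

@[simp] theorem val_bMat (y : Rˣ) (x : R) : (bMat y x).val = !![(y : R), x; 0, 1] := by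
  simp [bMat]

theorem zMat_comm (r : Rˣ) (g : GL (Fin 2) R) : zMat r * g = g * zMat r := by
  apply Units.ext
  simp [zMat, Matrix.scalar_apply, ← Matrix.smul_one_eq_diagonal]

theorem zMat_mul (r s : Rˣ) : zMat (r * s) = zMat r * zMat s := map_mul _ _ _

theorem zMat_one : zMat (1 : Rˣ) = 1 := map_one _

theorem zMat_inv (r : Rˣ) : zMat r⁻¹ = (zMat r)⁻¹ := map_inv _ _

theorem zMat_mul_mul (r s : Rˣ) (g h : GL (Fin 2) R) :
    zMat r * g * (zMat s * h) = zMat (r * s) * (g * h) := by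
  rw [zMat_mul, mul_assoc, ← mul_assoc g, ← zMat_comm s g]
  simp only [mul_assoc]

theorem zMat_mul_inv (r : Rˣ) (g : GL (Fin 2) R) : (zMat r * g)⁻¹ = zMat r⁻¹ * g⁻¹ := by
  rw [_root_.mul_inv_rev, ← zMat_inv, zMat_comm]

theorem nMat_add (x y : R) : nMat (x + y) = nMat x * nMat y := by
  apply Units.ext
  simp [add_comm]

theorem det_val_aMat (y : Rˣ) : (aMat y).val.det = y := by simp [Matrix.det_fin_two]

theorem map_aMat (f : R →+* S) (y : Rˣ) :
    Matrix.GeneralLinearGroup.map f (aMat y) = aMat (Units.map (f : R →* S) y) := by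
  apply Units.ext
  ext i j
  fin_cases i <;> fin_cases j <;> simp

theorem map_nMat (f : R →+* S) (x : R) :
    Matrix.GeneralLinearGroup.map f (nMat x) = nMat (f x) := by
  apply Units.ext
  ext i j
  fin_cases i <;> fin_cases j <;> simp

theorem map_weyl (f : R →+* S) :
    Matrix.GeneralLinearGroup.map f (weyl : GL (Fin 2) R) = weyl := by
  apply Units.ext
  ext i j
  fin_cases i <;> fin_cases j <;> simp

theorem map_zMat (f : R →+* S) (r : Rˣ) :
    Matrix.GeneralLinearGroup.map f (zMat r) = zMat (Units.map (f : R →* S) r) := by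
  apply Units.ext
  ext i j
  fin_cases i <;> fin_cases j <;> simp

theorem map_bMat (f : R →+* S) (y : Rˣ) (x : R) :
    Matrix.GeneralLinearGroup.map f (bMat y x) = bMat (Units.map (f : R →* S) y) (f x) := by
  simp [bMat, map_aMat, map_nMat]

end Ring

/-! ### The local groups at the finite places -/

section Local

variable {F : Type*} [Field F] [NumberField F] {p : HeightOneSpectrum (𝓞 F)}

theorem det_val_ne_zero {K : Type*} [Field K] (g : GL (Fin 2) K) : g.val.det ≠ 0 :=
  ((Matrix.isUnit_iff_isUnit_det _).1 g.isUnit).ne_zero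

/-- The determinants of g and g⁻¹ are both integral with product 1, hence units; conversely an
integral matrix with unit determinant is invertible over 𝔬_𝔭. -/
theorem mem_KFin_iff {g : GL (Fin 2) (p.adicCompletion F)} :
    g ∈ KFin p ↔ (∀ i j, Valued.v (g.val i j) ≤ 1) ∧ Valued.v g.val.det = 1 := by
  constructor
  · intro hg
    refine ⟨fun i j => valued_le_one_of_mem_KFin hg i j, ?_⟩
    have key : ∀ h ∈ KFin p, Valued.v h.val.det ≤ 1 := by
      intro h hh
      have hi : ∀ i j, Valued.v (h.val i j) ≤ 1 := fun i j => valued_le_one_of_mem_KFin hh i j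
      rw [Matrix.det_fin_two]
      refine (Valuation.map_sub _ _ _).trans (max_le ?_ ?_) <;> rw [map_mul] <;>
        exact mul_le_one' (hi _ _) (hi _ _)
    refine le_antisymm (key g hg) ?_
    have h1 := key g⁻¹ (inv_mem hg)
    have h2 : Valued.v g.val.det * Valued.v g⁻¹.val.det = 1 := by
      rw [← map_mul, ← Matrix.det_mul, ← Units.val_mul, mul_inv_cancel]
      simp
    calc (1 : WithZero (Multiplicative ℤ)) = Valued.v g.val.det * Valued.v g⁻¹.val.det := h2.symm
      _ ≤ Valued.v g.val.det * 1 := by gcongr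
      _ = _ := mul_one _
  · rintro ⟨h1, h2⟩
    let A : Matrix (Fin 2) (Fin 2) (p.adicCompletionIntegers F) :=
      Matrix.of fun i j => ⟨g.val i j, h1 i j⟩
    have hA : A.map (algebraMap (p.adicCompletionIntegers F) (p.adicCompletion F)) = g.val := by
      ext i j; rfl
    have hdet : algebraMap (p.adicCompletionIntegers F) (p.adicCompletion F) A.det
        = g.val.det := by
      rw [← hA, RingHom.map_det]; rfl
    have hu : IsUnit A.det := by
      rw [HeightOneSpectrum.adicCompletionIntegers.isUnit_iff_valued_eq_one]
      rw [← h2, ← hdet]; rfl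
    refine ⟨Matrix.GeneralLinearGroup.mk'' A hu, ?_⟩
    apply Units.ext
    exact hA

theorem mul_mem_K0Fin {n : ℕ} {g h : GL (Fin 2) (p.adicCompletion F)} (hg : g ∈ K0Fin p n)
    (hh : h ∈ K0Fin p n) : g * h ∈ K0Fin p n := by
  refine ⟨mul_mem hg.1 hh.1, ?_⟩
  have h1 := (mem_KFin_iff.1 hg.1).1
  have h2 := (mem_KFin_iff.1 hh.1).1
  rw [Units.val_mul, Matrix.mul_apply, Fin.sum_univ_two]
  refine (Valuation.map_add _ _ _).trans (max_le ?_ ?_) <;> rw [map_mul]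
  · exact mul_le_of_le_of_le_one hg.2 (h2 _ _)
  · exact mul_le_of_le_one_of_le (h1 _ _) hh.2

theorem val_inv_fin_two {K : Type*} [Field K] (g : GL (Fin 2) K) :
    g⁻¹.val = g.val.det⁻¹ • !![g.val 1 1, -g.val 0 1; -g.val 1 0, g.val 0 0] := by
  rw [Matrix.coe_units_inv, Matrix.inv_def, Matrix.adjugate_fin_two, Ring.inverse_eq_inv']

theorem inv_mem_K0Fin {n : ℕ} {g : GL (Fin 2) (p.adicCompletion F)} (hg : g ∈ K0Fin p n) :
    g⁻¹ ∈ K0Fin p n := by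
  refine ⟨inv_mem hg.1, ?_⟩
  rw [val_inv_fin_two]
  simpa [(mem_KFin_iff.1 hg.1).2] using hg.2

/-- The off-diagonal product is in the maximal ideal while the determinant is a unit, so the product
of the integral diagonal entries is a unit. -/
theorem valued_diag_of_mem_K0Fin {n : ℕ} (hn : 1 ≤ n) {g : GL (Fin 2) (p.adicCompletion F)}
    (hg : g ∈ K0Fin p n) : Valued.v (g.val 0 0) = 1 ∧ Valued.v (g.val 1 1) = 1 := by
  obtain ⟨h1, h2⟩ := mem_KFin_iff.1 hg.1
  have h3 : Valued.v (g.val 1 0) < 1 := by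
    refine hg.2.trans_lt ?_
    rw [← WithZero.exp_zero, WithZero.exp_lt_exp]
    omega
  have h4 : Valued.v (g.val 0 0 * g.val 1 1) = 1 := by
    have h5 : g.val 0 0 * g.val 1 1 = g.val.det + g.val 0 1 * g.val 1 0 := by
      rw [Matrix.det_fin_two]; ring
    rw [h5, Valuation.map_add_eq_of_lt_left, h2]
    rw [h2, map_mul]
    exact mul_lt_one_of_nonneg_of_lt_one_right (h1 _ _) zero_le h3
  rw [map_mul] at h4
  constructor
  · refine le_antisymm (h1 _ _) ?_
    rw [← h4]
    exact mul_le_of_le_one_right' (h1 _ _)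
  · refine le_antisymm (h1 _ _) ?_
    rw [← h4]
    exact mul_le_of_le_one_left' (h1 _ _)

variable (ϖ : Uniformizers F)

theorem valued_unit (p : HeightOneSpectrum (𝓞 F)) :
    Valued.v ((ϖ.unit p : (p.adicCompletion F)ˣ) : p.adicCompletion F)
      = WithZero.exp (-1 : ℤ) := (ϖ p).2

/-- Conjugation swaps the diagonal and turns the off-diagonal pair (b, c) into (c/ϖ, bϖ); the
divisibility of c by ϖ is exactly what keeps this integral. Thus (0 1; ϖ 0) normalises K₀(1). -/
theorem antiMat_conj_mem {g : GL (Fin 2) (p.adicCompletion F)} (hg : g ∈ K0Fin p 1) :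
    antiMat (ϖ.unit p) * g * (antiMat (ϖ.unit p))⁻¹ ∈ K0Fin p 1 := by
  have hϖ := valued_unit ϖ p
  obtain ⟨h1, h2⟩ := mem_KFin_iff.1 hg.1
  have hval : (antiMat (ϖ.unit p) * g * (antiMat (ϖ.unit p))⁻¹).val =
      !![g.val 1 1, g.val 1 0 * ((ϖ.unit p)⁻¹ : (p.adicCompletion F)ˣ);
        g.val 0 1 * ϖ.unit p, g.val 0 0] := by
    rw [Units.val_mul, Units.val_mul, val_inv_antiMat, val_antiMat, Matrix.eta_fin_two g.val,
      Matrix.mul_fin_two, Matrix.mul_fin_two]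
    ext i j
    fin_cases i <;> fin_cases j <;> simp [mul_comm, mul_left_comm]
  have hv : Valued.v (g.val 1 0 * ((ϖ.unit p)⁻¹ : (p.adicCompletion F)ˣ)) ≤ 1 := by
    rw [map_mul, Units.val_inv_eq_inv_val, map_inv₀, hϖ, ← WithZero.exp_neg, neg_neg]
    calc Valued.v (g.val 1 0) * WithZero.exp (1 : ℤ)
        ≤ WithZero.exp (-((1 : ℕ) : ℤ)) * WithZero.exp (1 : ℤ) := by gcongr; exact hg.2
      _ = 1 := by rw [← WithZero.exp_add]; simp
  have hu : Valued.v (g.val 0 1 * ϖ.unit p) ≤ WithZero.exp (-((1 : ℕ) : ℤ)) := by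
    rw [map_mul, hϖ]
    exact mul_le_of_le_one_of_le (h1 _ _) (by simp)
  refine ⟨mem_KFin_iff.2 ⟨?_, ?_⟩, ?_⟩
  · rw [hval]
    intro i j
    fin_cases i <;> fin_cases j
    · exact h1 1 1
    · exact hv
    · exact hu.trans (by rw [← WithZero.exp_zero, WithZero.exp_le_exp]; simp)
    · exact h1 0 0
  · rw [Units.val_mul, Units.val_mul, Matrix.det_mul, Matrix.det_mul, map_mul, map_mul, h2,
      mul_one, ← map_mul, ← Matrix.det_mul, ← Units.val_mul, mul_inv_cancel]
    simp
  · rw [hval]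
    exact hu

theorem antiMat_mul_self {R : Type*} [CommRing R] (u : Rˣ) : antiMat u * antiMat u = zMat u := by
  apply Units.ext
  simp

/-- The group generated by `K_{0,𝔭}(1)` and `(0 1; ϖ_𝔭 0)` consists, up to the centre, of the two
cosets of `K_{0,𝔭}(1)` of these elements. -/
theorem exists_of_mem_closure {g : GL (Fin 2) (p.adicCompletion F)}
    (hg : g ∈ Subgroup.closure (K0Fin p 1 ∪ {antiMat (ϖ.unit p)})) :
    ∃ z : (p.adicCompletion F)ˣ, ∃ u ∈ K0Fin p 1,
      g = zMat z * u ∨ g = zMat z * u * antiMat (ϖ.unit p) := by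
  have hone : (1 : GL (Fin 2) (p.adicCompletion F)) ∈ K0Fin p 1 := ⟨one_mem _, by simp⟩
  set A := antiMat (ϖ.unit p) with hA
  have hAA : A * A = zMat (ϖ.unit p) := antiMat_mul_self _
  induction hg using Subgroup.closure_induction with
  | mem x hx =>
    rcases hx with hx | hx
    · exact ⟨1, x, hx, Or.inl (by rw [zMat_one, one_mul])⟩
    · exact ⟨1, 1, hone, Or.inr (by rw [zMat_one, one_mul, one_mul]; exact hx)⟩
  | one => exact ⟨1, 1, hone, Or.inl (by rw [zMat_one, one_mul])⟩
  | mul x y _ _ hx hy =>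
    obtain ⟨z, u, hu, hx⟩ := hx
    obtain ⟨z', u', hu', hy⟩ := hy
    have hc := antiMat_conj_mem ϖ hu'
    rcases hx with rfl | rfl <;> rcases hy with rfl | rfl
    · refine ⟨z * z', u * u', mul_mem_K0Fin hu hu', Or.inl ?_⟩
      rw [zMat_mul_mul]
    · refine ⟨z * z', u * u', mul_mem_K0Fin hu hu', Or.inr ?_⟩
      rw [← mul_assoc, zMat_mul_mul]
    · refine ⟨z * z', u * (A * u' * A⁻¹), mul_mem_K0Fin hu hc, Or.inr ?_⟩
      rw [mul_assoc (zMat z) u A, zMat_mul_mul]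
      group
    -- Here A u' A = (A u' A⁻¹) A², and A² is the scalar ϖ.
    · refine ⟨z * z' * ϖ.unit p, u * (A * u' * A⁻¹), mul_mem_K0Fin hu hc, Or.inl ?_⟩
      rw [zMat_mul _ (ϖ.unit p), mul_assoc (zMat (z * z')), zMat_comm (ϖ.unit p), ← hAA,
        mul_assoc (zMat z) u A, mul_assoc (zMat z') u' A, zMat_mul_mul]
      group
  | inv x _ hx =>
    obtain ⟨z, u, hu, hx⟩ := hx
    have hu' := inv_mem_K0Fin hu
    have hc := antiMat_conj_mem ϖ hu'
    rcases hx with rfl | rfl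
    · exact ⟨z⁻¹, u⁻¹, hu', Or.inl (zMat_mul_inv _ _)⟩
    · refine ⟨z⁻¹ * (ϖ.unit p)⁻¹, A * u⁻¹ * A⁻¹, hc, Or.inr ?_⟩
      rw [mul_assoc, zMat_mul_inv, zMat_mul, zMat_inv (ϖ.unit p), ← hAA]
      group

/-- A matrix with lower row `(c, d)`, where `c ≠ 0` and `|d| ≤ |c| q ^ m`, has invariant at most
`m`. -/
theorem lInv_le {n m : ℕ} (hm : m ≤ n) {g : GL (Fin 2) (p.adicCompletion F)}
    (hc : g.val 1 0 ≠ 0)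
    (hd : Valued.v (g.val 1 1) ≤ Valued.v (g.val 1 0) * WithZero.exp (m : ℤ)) :
    lInv ϖ p n g ≤ m := by
  set a := g.val 0 0 with ha
  set b := g.val 0 1 with hb
  set c := g.val 1 0 with hc'
  set d := g.val 1 1 with hd'
  have hdet : g.val.det = a * d - b * c := Matrix.det_fin_two _
  set D := g.val.det with hD
  have hD0 : D ≠ 0 := det_val_ne_zero g
  -- The Bruhat decomposition is g = z(-c) n(a/c) a(D/c²) ω n(d/c). Writing D/c² = ϖ^t υ with a unit
  -- υ and moving υ to the right replaces d/c by s = d/(cυ).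
  obtain ⟨t, ht⟩ : ∃ t : ℤ, Valued.v (D / c ^ 2) = WithZero.exp (-t) := by
    refine ⟨-WithZero.log (Valued.v (D / c ^ 2)), ?_⟩
    rw [neg_neg, WithZero.exp_log]
    rw [Valuation.ne_zero_iff]
    positivity
  set P : p.adicCompletion F := ((ϖ.unit p ^ t : (p.adicCompletion F)ˣ) : p.adicCompletion F)
    with hP
  have hP0 : P ≠ 0 := Units.ne_zero _
  have hvP : Valued.v P = WithZero.exp (-t) := by
    rw [hP, Units.val_zpow_eq_zpow_val, map_zpow₀, valued_unit, ← WithZero.exp_zsmul]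
    simp
  set υ : p.adicCompletion F := D / c ^ 2 / P with hυ
  have hυ1 : Valued.v υ = 1 := by
    rw [hυ, map_div₀, ht, hvP, div_self WithZero.exp_ne_zero]
  have hυ0 : υ ≠ 0 := by
    intro h
    rw [h, map_zero] at hυ1
    exact zero_ne_one hυ1
  set s : p.adicCompletion F := d / (c * υ) with hs
  have hvs : Valued.v s ≤ WithZero.exp (m : ℤ) := by
    rw [hs, map_div₀, map_mul, hυ1, mul_one]
    exact div_le_of_le_mul₀ zero_le zero_le (by rwa [mul_comm])
  -- The integral part r of s and the unit υ are absorbed in the upper triangular matrix k, which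
  -- lies in K₁(n) for every n.
  have key : ∀ l : ℕ, l ≤ n → ∀ v r : p.adicCompletion F, Valued.v v = 1 → Valued.v r ≤ 1 →
      s = ((ϖ.unit p ^ (-(l : ℤ)) : (p.adicCompletion F)ˣ) : p.adicCompletion F) * v + r →
      lInv ϖ p n g ≤ l := by
    intro l hl v r hv hr hsr
    refine Nat.sInf_le ⟨hl, Units.mk0 (-c) (neg_ne_zero.2 hc), a / c, t, v, hv, ?_⟩
    let k : GL (Fin 2) (p.adicCompletion F) :=
      Matrix.GeneralLinearGroup.mkOfDetNeZero !![1, r * υ; 0, υ] (by simpa using hυ0)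
    have hk : k.val = !![1, r * υ; 0, υ] := rfl
    refine ⟨k, ⟨mem_KFin_iff.2 ⟨?_, ?_⟩, ?_, ?_⟩, ?_⟩
    · rw [hk]
      intro i j
      fin_cases i <;> fin_cases j <;> simp [hυ1, hr]
    · rw [hk]
      simp [hυ1]
    · rw [hk]
      simp
    · rw [hk]
      simp
    · apply Units.ext
      simp only [Units.val_mul, val_zMat, val_nMat, val_aMat, val_weyl, hk]
      rw [← hP]
      set Q := ((ϖ.unit p ^ (-(l : ℤ)) : (p.adicCompletion F)ˣ) : p.adicCompletion F)
      have hQ : Q * v * υ + r * υ = d / c := by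
        rw [← add_mul, ← hsr, hs]
        field_simp
      have hPυ : P * υ = D / c ^ 2 := by
        rw [hυ]
        field_simp
      rw [Matrix.eta_fin_two g.val, ← ha, ← hb, ← hc', ← hd']
      simp only [Matrix.mul_fin_two]
      have h00 : a = -c * (a / c * -1) := by field_simp
      have h01 : b = -c * (P * υ) + -c * (a / c) * (-(Q * v * υ + r * υ)) := by
        rw [hQ, hPυ, hdet]
        field_simp
        ring
      have h11 : d = -c * (-(Q * v * υ + r * υ)) := by
        rw [hQ]
        field_simp
      refine Matrix.ext fun i j => ?_
      fin_cases i <;> fin_cases j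
      · simpa using h00
      · simp
        linear_combination h01
      · simp
      · simp
        linear_combination h11
  -- The parameter v must be a unit even for l = 0, so an integral s is split as 1 + (s - 1).
  -- Otherwise s itself is ϖ^{-l} times a unit with 0 < l ≤ m.
  by_cases hs1 : Valued.v s ≤ 1
  · refine (key 0 (Nat.zero_le _) 1 (s - 1) (map_one _) ?_ (by simp)).trans (Nat.zero_le _)
    exact (Valuation.map_sub _ _ _).trans (max_le hs1 (by simp))
  · have hs0 : Valued.v s ≠ 0 := by
      intro h
      rw [h] at hs1
      exact hs1 zero_le
    have hl0 : 0 < WithZero.log (Valued.v s) := by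
      rw [← WithZero.exp_lt_exp, WithZero.exp_log hs0, WithZero.exp_zero]
      exact not_le.1 hs1
    obtain ⟨l, hl⟩ := Int.eq_ofNat_of_zero_le hl0.le
    have hls : Valued.v s = WithZero.exp (l : ℤ) := by rw [← hl, WithZero.exp_log hs0]
    have hlm : l ≤ m := by
      rw [hls, WithZero.exp_le_exp] at hvs
      exact_mod_cast hvs
    refine (key l (hlm.trans hm) (s * ((ϖ.unit p ^ (l : ℤ) : (p.adicCompletion F)ˣ)
      : p.adicCompletion F)) 0 ?_ (by simp) ?_).trans hlm
    · rw [map_mul, hls, Units.val_zpow_eq_zpow_val, map_zpow₀, valued_unit, ← WithZero.exp_zsmul,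
        ← WithZero.exp_add]
      simp
    · rw [add_zero, mul_left_comm, ← Units.val_mul, ← _root_.zpow_add]
      simp

end Local

/-! ### Exponents of ideals -/

section Ideals

variable {F : Type*} [Field F] [NumberField F]

theorem ordAt_mul {I J : Ideal (𝓞 F)} (hI : I ≠ 0) (hJ : J ≠ 0) (p : HeightOneSpectrum (𝓞 F)) :
    ordAt (I * J) p = ordAt I p + ordAt J p := by
  classical
  unfold ordAt
  rw [← Associates.mk_mul_mk]
  exact Associates.count_mul (Associates.mk_ne_zero.2 hI) (Associates.mk_ne_zero.2 hJ)
    p.associates_irreducible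

theorem ordAt_one (p : HeightOneSpectrum (𝓞 F)) : ordAt (1 : Ideal (𝓞 F)) p = 0 := by
  classical
  unfold ordAt
  rw [Associates.mk_one, Associates.factors_one, Associates.count_zero p.associates_irreducible]

theorem ordAt_asIdeal_pow_self (p : HeightOneSpectrum (𝓞 F)) (n : ℕ) :
    ordAt (p.asIdeal ^ n) p = n := by
  classical
  unfold ordAt
  rw [Associates.mk_pow, Associates.count_pow p.associates_irreducible.ne_zero
    p.associates_irreducible, Associates.count_self p.associates_irreducible, mul_one]

theorem ordAt_asIdeal_pow_of_ne {p q : HeightOneSpectrum (𝓞 F)} (h : q ≠ p) (n : ℕ) :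
    ordAt (q.asIdeal ^ n) p = 0 := by
  classical
  unfold ordAt
  rw [Associates.mk_pow, Associates.count_pow q.associates_irreducible.ne_zero
    p.associates_irreducible, Associates.count_eq_zero_of_ne p.associates_irreducible
    q.associates_irreducible, mul_zero]
  intro h'
  rw [Associates.mk_eq_mk_iff_associated, associated_iff_eq] at h'
  exact h (HeightOneSpectrum.ext h'.symm)

theorem dvd_iff_ordAt_ne_zero {I : Ideal (𝓞 F)} (hI : I ≠ 0) (p : HeightOneSpectrum (𝓞 F)) :
    p.asIdeal ∣ I ↔ ordAt I p ≠ 0 := by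
  classical
  exact (Associates.count_ne_zero_iff_dvd hI p.irreducible).symm

theorem prod_asIdeal_pow_ne_zero (s : Finset (HeightOneSpectrum (𝓞 F)))
    (e : HeightOneSpectrum (𝓞 F) → ℕ) : ∏ q ∈ s, q.asIdeal ^ e q ≠ 0 :=
  Finset.prod_ne_zero_iff.2 fun q _ => pow_ne_zero _ q.ne_bot

open Classical in
theorem ordAt_prod (s : Finset (HeightOneSpectrum (𝓞 F))) (e : HeightOneSpectrum (𝓞 F) → ℕ)
    (p : HeightOneSpectrum (𝓞 F)) :
    ordAt (∏ q ∈ s, q.asIdeal ^ e q) p = if p ∈ s then e p else 0 := by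
  induction s using Finset.induction_on with
  | empty => simpa using ordAt_one p
  | insert q s hq ih =>
    rw [Finset.prod_insert hq, ordAt_mul (pow_ne_zero _ q.ne_bot) (prod_asIdeal_pow_ne_zero s e),
      ih]
    by_cases h : q = p
    · subst h
      simp [hq, ordAt_asIdeal_pow_self]
    · simp [ordAt_asIdeal_pow_of_ne h, Ne.symm h]

theorem finprod_asIdeal_pow_eq {e : HeightOneSpectrum (𝓞 F) → ℕ}
    (he : ∀ᶠ p in Filter.cofinite, e p = 0) :
    ∏ᶠ p : HeightOneSpectrum (𝓞 F), p.asIdeal ^ e p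
      = ∏ q ∈ (Filter.eventually_cofinite.1 he).toFinset, q.asIdeal ^ e q := by
  refine finprod_eq_prod_of_mulSupport_subset _ fun p hp => ?_
  rw [Set.Finite.coe_toFinset]
  intro h
  apply hp
  change p.asIdeal ^ e p = 1
  rw [h, pow_zero]

theorem finprod_asIdeal_pow_ne_zero {e : HeightOneSpectrum (𝓞 F) → ℕ}
    (he : ∀ᶠ p in Filter.cofinite, e p = 0) :
    ∏ᶠ p : HeightOneSpectrum (𝓞 F), p.asIdeal ^ e p ≠ 0 := by
  rw [finprod_asIdeal_pow_eq he]
  exact prod_asIdeal_pow_ne_zero _ _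

theorem ordAt_finprod {e : HeightOneSpectrum (𝓞 F) → ℕ}
    (he : ∀ᶠ p in Filter.cofinite, e p = 0) (p : HeightOneSpectrum (𝓞 F)) :
    ordAt (∏ᶠ q : HeightOneSpectrum (𝓞 F), q.asIdeal ^ e q) p = e p := by
  classical
  rw [finprod_asIdeal_pow_eq he, ordAt_prod]
  split_ifs with h
  · rfl
  · rw [Set.Finite.mem_toFinset] at h
    exact (not_not.1 h).symm

theorem sqfree_exponent_eventually (𝔫 : Ideal (𝓞 F)) :
    ∀ᶠ p in Filter.cofinite, ord1 𝔫 p - ord0 𝔫 p = 0 := by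
  filter_upwards [ordAt_eventually_eq_zero 𝔫] with p hp
  simp [ord1, hp]

theorem sqfreePart_ne_zero (𝔫 : Ideal (𝓞 F)) : sqfreePart 𝔫 ≠ 0 :=
  finprod_asIdeal_pow_ne_zero (sqfree_exponent_eventually 𝔫)

theorem dvd_sqfreePart_iff (𝔫 : Ideal (𝓞 F)) (p : HeightOneSpectrum (𝓞 F)) :
    p.asIdeal ∣ sqfreePart 𝔫 ↔ ord1 𝔫 p = ord0 𝔫 p + 1 := by
  rw [dvd_iff_ordAt_ne_zero (sqfreePart_ne_zero 𝔫), sqfreePart,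
    ordAt_finprod (sqfree_exponent_eventually 𝔫)]
  unfold ord0 ord1
  omega

theorem ord1_eq_ord0_of_not_dvd {𝔫 : Ideal (𝓞 F)} {p : HeightOneSpectrum (𝓞 F)}
    (h : ¬ p.asIdeal ∣ sqfreePart 𝔫) : ord1 𝔫 p = ord0 𝔫 p := by
  rw [dvd_sqfreePart_iff] at h
  unfold ord0 ord1 at *
  omega

theorem finite_setOf_dvd {I : Ideal (𝓞 F)} (hI : I ≠ 0) :
    {p : HeightOneSpectrum (𝓞 F) | p.asIdeal ∣ I}.Finite := Ideal.finite_factors hI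

/-- Every set of prime divisors of `𝔫₂` is the set of prime divisors of a divisor of `𝔫₂`. -/
theorem exists_dvd_sqfreePart (𝔫 : Ideal (𝓞 F)) (T : Set (HeightOneSpectrum (𝓞 F)))
    (hT : ∀ p ∈ T, p.asIdeal ∣ sqfreePart 𝔫) :
    ∃ 𝔏 : Ideal (𝓞 F), 𝔏 ∣ sqfreePart 𝔫 ∧ ∀ p, p.asIdeal ∣ 𝔏 ↔ p ∈ T := by
  classical
  have hfin : T.Finite := (finite_setOf_dvd (sqfreePart_ne_zero 𝔫)).subset hT
  -- Primes dividing 𝔫₂ occur in it with exponent 1, so the product over `T` divides it.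
  refine ⟨∏ q ∈ hfin.toFinset, q.asIdeal ^ 1, ?_, fun p => ?_⟩
  · rw [sqfreePart, finprod_asIdeal_pow_eq (sqfree_exponent_eventually 𝔫)]
    have hsub : hfin.toFinset ⊆ (Filter.eventually_cofinite.1
        (sqfree_exponent_eventually 𝔫)).toFinset := by
      intro p hp
      rw [Set.Finite.mem_toFinset] at hp ⊢
      have h := (dvd_sqfreePart_iff 𝔫 p).1 (hT p hp)
      change ¬ (_ = 0)
      omega
    refine dvd_trans (Finset.prod_dvd_prod_of_dvd _ _ fun q hq => ?_)
      (Finset.prod_dvd_prod_of_subset _ _ _ hsub)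
    rw [Set.Finite.mem_toFinset] at hq
    have h := (dvd_sqfreePart_iff 𝔫 q).1 (hT q hq)
    exact pow_dvd_pow _ (by omega)
  · rw [dvd_iff_ordAt_ne_zero (prod_asIdeal_pow_ne_zero _ _), ordAt_prod]
    simp

end Ideals

/-! ### Approximation of finite adeles -/

section Approximation

variable {F : Type*} [Field F] [NumberField F]

open HeightOneSpectrum

theorem valued_embedding (p : HeightOneSpectrum (𝓞 F)) (a : F) :
    Valued.v (FinitePlace.embedding p a) = p.valuation F a :=
  valuedAdicCompletion_eq_valuation' p a

theorem valued_embedding_int (p : HeightOneSpectrum (𝓞 F)) (r : 𝓞 F) :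
    Valued.v (FinitePlace.embedding p (algebraMap (𝓞 F) F r)) = p.intValuation r := by
  rw [valued_embedding, valuation_of_algebraMap]

theorem intValuation_eq_exp_ordAt (p : HeightOneSpectrum (𝓞 F)) {r : 𝓞 F} (hr : r ≠ 0) :
    p.intValuation r = WithZero.exp (-(ordAt (Ideal.span {r}) p : ℤ)) := by
  classical
  rw [intValuation_if_neg _ hr, ordAt]

/-- There is a nonzero integer which is divisible by prescribed powers of the primes. -/
theorem exists_intValuation_le {e : HeightOneSpectrum (𝓞 F) → ℕ}
    (he : ∀ᶠ p in Filter.cofinite, e p = 0) :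
    ∃ r : 𝓞 F, r ≠ 0 ∧ ∀ p : HeightOneSpectrum (𝓞 F),
      p.intValuation r ≤ WithZero.exp (-(e p : ℤ)) := by
  have h0 := finprod_asIdeal_pow_ne_zero he
  obtain ⟨r, hr, hr0⟩ := Submodule.exists_mem_ne_zero_of_ne_bot h0
  refine ⟨r, hr0, fun p => ?_⟩
  rw [intValuation_eq_exp_ordAt p hr0, WithZero.exp_le_exp]
  obtain ⟨J, hJ⟩ := Ideal.dvd_span_singleton.2 hr
  have hs : Ideal.span {r} ≠ 0 := by simpa using hr0
  have hJ0 : J ≠ 0 := by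
    rintro rfl
    exact hs (by rw [hJ, mul_zero])
  rw [hJ, ordAt_mul h0 hJ0, ordAt_finprod he]
  push_cast
  omega

/-- The exponents of the denominators of a finite adele. -/
theorem exists_valued_le (x : FinAdele F) : ∃ e : HeightOneSpectrum (𝓞 F) → ℕ,
    (∀ᶠ p in Filter.cofinite, e p = 0) ∧ ∀ p, Valued.v (x p) ≤ WithZero.exp (e p : ℤ) := by
  refine ⟨fun p => (WithZero.log (Valued.v (x p))).toNat, ?_, fun p => ?_⟩
  · filter_upwards [x.2] with p hp
    have h : Valued.v (x p) ≤ 1 := hp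
    rw [Int.toNat_eq_zero]
    by_cases h0 : Valued.v (x p) = 0
    · rw [h0, WithZero.log_zero]
    · rwa [← WithZero.exp_le_exp, WithZero.exp_log h0, WithZero.exp_zero]
  · by_cases h0 : Valued.v (x p) = 0
    · rw [h0]; exact zero_le
    · rw [← WithZero.exp_log h0, WithZero.exp_le_exp]
      exact Int.self_le_toNat _

/-- Density of F gives an approximation a in F, which is 𝔭-integral because y is; such an a is
congruent to an element of 𝓞 F modulo any power of 𝔭. -/
theorem exists_int_valued_sub_le (p : HeightOneSpectrum (𝓞 F)) {y : p.adicCompletion F}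
    (hy : Valued.v y ≤ 1) (m : ℕ) : ∃ r : 𝓞 F,
      Valued.v (y - FinitePlace.embedding p (algebraMap (𝓞 F) F r)) ≤ WithZero.exp (-(m : ℤ)) := by
  have hexp : WithZero.exp (-(m : ℤ)) ≤ (1 : WithZero (Multiplicative ℤ)) := by
    rw [← WithZero.exp_zero, WithZero.exp_le_exp]; omega
  obtain ⟨a, ha⟩ : ∃ a : F, Valued.v (FinitePlace.embedding p a - y) < WithZero.exp (-(m : ℤ)) := by
    have hopen : {b : p.adicCompletion F | Valued.v (b - y) < WithZero.exp (-(m : ℤ))}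
        ∈ nhds y := by
      obtain ⟨c, hc⟩ := valuedAdicCompletion_surjective F p (WithZero.exp (-(m : ℤ)))
      have hc0 : c ≠ 0 := by
        rw [← Valuation.ne_zero_iff Valued.v, hc]
        exact WithZero.exp_ne_zero
      refine Valued.mem_nhds.2 ⟨Units.mk0 (Valued.v.restrict c) ?_, fun b hb => ?_⟩
      · exact (Valuation.ne_zero_iff _).2 hc0
      · rw [Set.mem_ofPred_eq, ← hc]
        exact (Valuation.restrict_lt_iff _).1 hb
    obtain ⟨a, ha⟩ := (denseRange_algebraMap F p).mem_nhds hopen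
    exact ⟨a, ha⟩
  have hva : p.valuation F a ≤ 1 := by
    rw [← valued_embedding]
    have : FinitePlace.embedding p a = (FinitePlace.embedding p a - y) + y := by ring
    rw [this]
    exact (Valuation.map_add _ _ _).trans (max_le (ha.le.trans hexp) hy)
  obtain ⟨r, hr⟩ := exists_valuation_sub_lt_of_integer p hva
    (Units.mk0 (WithZero.exp (-(m : ℤ))) WithZero.exp_ne_zero)
  refine ⟨r, ?_⟩
  have : y - FinitePlace.embedding p (algebraMap (𝓞 F) F r)
      = -(FinitePlace.embedding p a - y)
        - FinitePlace.embedding p (algebraMap (𝓞 F) F r - a) := by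
    rw [map_sub]; ring
  rw [this]
  refine (Valuation.map_sub _ _ _).trans (max_le ?_ ?_)
  · rw [Valuation.map_neg]; exact ha.le
  · rw [valued_embedding]; exact hr.le

/-- The field `F` is dense in the finite adeles. -/
theorem exists_valued_sub_le (x : FinAdele F) {e : HeightOneSpectrum (𝓞 F) → ℕ}
    (he : ∀ᶠ p in Filter.cofinite, e p = 0) :
    ∃ a : F, ∀ p, Valued.v (x p - FinitePlace.embedding p a) ≤ WithZero.exp (-(e p : ℤ)) := by
  obtain ⟨d, hd, hxd⟩ := exists_valued_le x
  obtain ⟨N, hN0, hN⟩ := exists_intValuation_le hd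
  set ι : ∀ p : HeightOneSpectrum (𝓞 F), 𝓞 F → p.adicCompletion F :=
    fun p r => FinitePlace.embedding p (algebraMap (𝓞 F) F r) with hι
  have hNx : ∀ p, Valued.v (ι p N * x p) ≤ 1 := by
    intro p
    rw [map_mul, valued_embedding_int]
    calc _ ≤ WithZero.exp (-(d p : ℤ)) * WithZero.exp (d p : ℤ) := mul_le_mul' (hN p) (hxd p)
      _ = 1 := by rw [← WithZero.exp_add]; simp
  -- N clears the denominators of x. Dividing by N at the end loses v_𝔭(N), so N x is approximated
  -- to that much more precision.
  let E : HeightOneSpectrum (𝓞 F) → ℕ := fun p => e p + ordAt (Ideal.span {N}) p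
  have hE : ∀ᶠ p in Filter.cofinite, E p = 0 := by
    filter_upwards [he, ordAt_eventually_eq_zero (Ideal.span {N})] with p h1 h2
    simp [E, h1, h2]
  choose r hr using fun p => exists_int_valued_sub_le p (hNx p) (E p)
  -- The Chinese remainder theorem at the finitely many primes with E ≠ 0; at the others integrality
  -- of both terms suffices.
  obtain ⟨R, hR⟩ := IsDedekindDomain.exists_forall_sub_mem_ideal 
    (s := (Filter.eventually_cofinite.1 hE).toFinset)
    (fun p : HeightOneSpectrum (𝓞 F) => p.asIdeal) E (fun p _ => p.prime)
    (fun p _ q _ hpq h => hpq (HeightOneSpectrum.ext h)) (fun p => r p)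
  have key : ∀ p, Valued.v (ι p N * x p - ι p R) ≤ WithZero.exp (-(E p : ℤ)) := by
    intro p
    by_cases hp : E p = 0
    · rw [hp]
      refine (Valuation.map_sub _ _ _).trans (max_le ?_ ?_)
      · simpa using hNx p
      · rw [valued_embedding_int]
        simpa using p.intValuation_le_one R
    · have h1 := hR p (by rw [Set.Finite.mem_toFinset]; exact hp)
      have h2 : ι p N * x p - ι p R = (ι p N * x p - ι p (r p)) - ι p (R - r p) := by
        simp only [hι, map_sub]; ring
      rw [h2]
      refine (Valuation.map_sub _ _ _).trans (max_le (hr p) ?_)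
      rw [valued_embedding_int]
      exact (p.intValuation_le_pow_iff_mem _ _).2 h1
  have hNF : algebraMap (𝓞 F) F N ≠ 0 := by simpa using hN0
  refine ⟨algebraMap (𝓞 F) F R / algebraMap (𝓞 F) F N, fun p => ?_⟩
  have hN1 : ι p N ≠ 0 := by
    simp only [hι]
    exact (map_ne_zero _).2 hNF
  have h1 : x p - FinitePlace.embedding p (algebraMap (𝓞 F) F R / algebraMap (𝓞 F) F N)
      = (ι p N * x p - ι p R) / ι p N := by
    rw [map_div₀, sub_div, mul_div_cancel_left₀ _ hN1]
  rw [h1, map_div₀, valued_embedding_int, intValuation_eq_exp_ordAt p hN0]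
  refine div_le_of_le_mul₀ zero_le zero_le ((key p).trans ?_)
  rw [← WithZero.exp_add, WithZero.exp_le_exp]
  simp only [E]
  push_cast
  omega

/-- Every finite idele is the product of a principal idele, one of the class representatives, and
an idele of units. -/
theorem exists_class_representative {θ : Fin (NumberField.classNumber F) → (FinAdele F)ˣ}
    (hθ : IsClassRepresentatives θ) (δ : (FinAdele F)ˣ) :
    ∃ i, ∃ α : Fˣ, ∀ p, Valued.v ((δ : FinAdele F) p) =
      Valued.v (FinitePlace.embedding p (α : F)) * Valued.v ((θ i : FinAdele F) p) := by
  have hunit := FiniteAdeleRing.isUnit_iff.1 δ.isUnit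
  obtain ⟨d, hd, hxd⟩ := exists_valued_le (δ : FinAdele F)
  obtain ⟨N, hN0, hN⟩ := exists_intValuation_le hd
  have hNF : algebraMap (𝓞 F) F N ≠ 0 := by simpa using hN0
  -- The exponents of the ideal of Nδ, integral by the choice of N.
  let f : HeightOneSpectrum (𝓞 F) → ℤ := fun p =>
    ordAt (Ideal.span {N}) p - WithZero.log (Valued.v ((δ : FinAdele F) p))
  have hδ0 : ∀ p, Valued.v ((δ : FinAdele F) p) ≠ 0 := fun p =>
    (Valuation.ne_zero_iff _).2 (hunit.1 p)
  have hf : ∀ p, 0 ≤ f p := by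
    intro p
    have h1 := hN p
    have h2 := hxd p
    rw [intValuation_eq_exp_ordAt p hN0, WithZero.exp_le_exp] at h1
    rw [← WithZero.exp_log (hδ0 p), WithZero.exp_le_exp] at h2
    simp only [f]
    omega
  have he : ∀ᶠ p in Filter.cofinite, (f p).toNat = 0 := by
    filter_upwards [ordAt_eventually_eq_zero (Ideal.span {N}), hunit.2] with p h1 h2
    simp [f, h1, h2]
  let J : (Ideal (𝓞 F))⁰ := ⟨_, mem_nonZeroDivisors_of_ne_zero (finprod_asIdeal_pow_ne_zero he)⟩
  obtain ⟨i, ⟨I, hI, hIJ⟩, -⟩ := hθ.existsUnique (ClassGroup.mk0 J)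
  -- From (a) I = (b) J, with J the ideal of Nδ and I that of θ_i, the principal idele is a/(bN).
  obtain ⟨a, b, ha, hb, hab⟩ := ClassGroup.mk0_eq_mk0_iff.1 hIJ
  have haF : algebraMap (𝓞 F) F a ≠ 0 := by simpa using ha
  have hbF : algebraMap (𝓞 F) F b ≠ 0 := by simpa using hb
  refine ⟨i, Units.mk0 (algebraMap (𝓞 F) F a / (algebraMap (𝓞 F) F b * algebraMap (𝓞 F) F N))
    (by positivity), fun p => ?_⟩
  have h1 := congrArg (fun I => ordAt I p) hab
  rw [ordAt_mul (by simpa using ha) (nonZeroDivisors.ne_zero I.2),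
    ordAt_mul (by simpa using hb) (nonZeroDivisors.ne_zero J.2)] at h1
  have h2 : ordAt (J : Ideal (𝓞 F)) p = (f p).toNat := ordAt_finprod he p
  rw [h2] at h1
  rw [Units.val_mk0, map_div₀, map_mul, map_div₀, map_mul, valued_embedding_int,
    valued_embedding_int, valued_embedding_int, intValuation_eq_exp_ordAt p ha,
    intValuation_eq_exp_ordAt p hb, intValuation_eq_exp_ordAt p hN0, hI p,
    ← WithZero.exp_log (hδ0 p), ← WithZero.exp_add, ← WithZero.exp_sub, ← WithZero.exp_add]
  congr 1
  have h3 := hf p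
  have h4 : ((f p).toNat : ℤ) = f p := Int.toNat_of_nonneg (hf p)
  simp only [f] at h3 h4 h1
  omega

end Approximation

/-! ### Strong approximation -/

section StrongApproximation

variable {F : Type*} [Field F] [NumberField F]

/-- The diagonal embedding `GL₂(F) → GL₂(𝔸_fin)`. -/
noncomputable def rationalFin : GL (Fin 2) F →* GL (Fin 2) (FinAdele F) :=
  Matrix.GeneralLinearGroup.map (algebraMap F (FinAdele F))

theorem finPart_rational (γ : GL (Fin 2) F) : finPart (rational γ) = rationalFin γ := rfl

/-- A subgroup of `GL₂(𝔸_fin)` whose intersection with `SL₂(𝔸_fin)` contains a principal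
congruence subgroup. -/
def ContainsCongruence (H : Subgroup (GL (Fin 2) (FinAdele F))) : Prop :=
  ∃ e : HeightOneSpectrum (𝓞 F) → ℕ, (∀ᶠ p in Filter.cofinite, e p = 0) ∧
    ∀ g : GL (Fin 2) (FinAdele F), g.val.det = 1 →
      (∀ p i j, Valued.v (evalFin p ((g.val - 1) i j)) ≤ WithZero.exp (-(e p : ℤ))) → g ∈ H

theorem exists_matrix_valued_le (A : Matrix (Fin 2) (Fin 2) (FinAdele F)) :
    ∃ e : HeightOneSpectrum (𝓞 F) → ℕ, (∀ᶠ p in Filter.cofinite, e p = 0) ∧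
      ∀ p i j, Valued.v (evalFin p (A i j)) ≤ WithZero.exp (e p : ℤ) := by
  choose d hd hA using fun ij : Fin 2 × Fin 2 => exists_valued_le (A ij.1 ij.2)
  refine ⟨fun p => ∑ ij, d ij p, ?_, fun p i j => (hA (i, j) p).trans ?_⟩
  · filter_upwards [Filter.eventually_all.2 hd] with p hp
    simp [hp]
  · rw [WithZero.exp_le_exp]
    exact_mod_cast Finset.single_le_sum (f := fun ij => d ij p) (fun _ _ => Nat.zero_le _)
      (Finset.mem_univ (i, j))

theorem valued_mul_apply_le {p : HeightOneSpectrum (𝓞 F)}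
    {A B : Matrix (Fin 2) (Fin 2) (FinAdele F)} {a b : ℤ}
    (hA : ∀ i j, Valued.v (evalFin p (A i j)) ≤ WithZero.exp a)
    (hB : ∀ i j, Valued.v (evalFin p (B i j)) ≤ WithZero.exp b) (i j : Fin 2) :
    Valued.v (evalFin p ((A * B) i j)) ≤ WithZero.exp (a + b) := by
  rw [Matrix.mul_apply, Fin.sum_univ_two, map_add, map_mul, map_mul, WithZero.exp_add]
  refine (Valuation.map_add _ _ _).trans (max_le ?_ ?_) <;> rw [map_mul] <;>
    exact mul_le_mul' (hA _ _) (hB _ _)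

/-- Since c g c⁻¹ - 1 = c (g - 1) c⁻¹, conjugation costs only the denominators of c and c⁻¹, which
are trivial at almost all primes. -/
theorem ContainsCongruence.comap_conj {H : Subgroup (GL (Fin 2) (FinAdele F))}
    (hH : ContainsCongruence H) (c : GL (Fin 2) (FinAdele F)) :
    ContainsCongruence (H.comap (MulAut.conj c).toMonoidHom) := by
  obtain ⟨e, he, hH⟩ := hH
  obtain ⟨d, hd, hc⟩ := exists_matrix_valued_le c.val
  obtain ⟨d', hd', hc'⟩ := exists_matrix_valued_le c⁻¹.val
  refine ⟨fun p => e p + d p + d' p, ?_, fun g hg1 hg => hH _ ?_ fun p i j => ?_⟩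
  · filter_upwards [he, hd, hd'] with p h1 h2 h3
    simp [h1, h2, h3]
  · have h : c.val.det * c⁻¹.val.det = 1 := by
      rw [← Matrix.det_mul, ← Units.val_mul, mul_inv_cancel, Units.val_one, Matrix.det_one]
    change (c.val * g.val * c⁻¹.val).det = 1
    rw [Matrix.det_mul, Matrix.det_mul, hg1, mul_one, h]
  · have h : ((MulAut.conj c).toMonoidHom g).val - 1 = c.val * (g.val - 1) * c⁻¹.val := by
      have hcc : c.val * c⁻¹.val = 1 := by rw [← Units.val_mul, mul_inv_cancel, Units.val_one]
      change c.val * g.val * c⁻¹.val - 1 = _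
      rw [mul_sub, sub_mul, mul_one, hcc]
    rw [h]
    refine (valued_mul_apply_le (valued_mul_apply_le (hc p) (hg p)) (hc' p) i j).trans ?_
    rw [WithZero.exp_le_exp]
    push_cast
    omega

/-- An element of `GL₂(𝔸_fin)` which is a limit of elements of `GL₂(F)`. -/
def IsApproximable (g : GL (Fin 2) (FinAdele F)) : Prop :=
  ∀ H : Subgroup (GL (Fin 2) (FinAdele F)), ContainsCongruence H →
    ∃ γ : GL (Fin 2) F, ∃ h ∈ H, g = rationalFin γ * h

/-- In γ₁k₁γ₂k₂ = γ₁γ₂ (γ₂⁻¹k₁γ₂) k₂ the error k₁ gets conjugated, so g₁ is approximated modulo a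
conjugate of H chosen after γ₂. -/
theorem IsApproximable.mul {g₁ g₂ : GL (Fin 2) (FinAdele F)} (h₁ : IsApproximable g₁)
    (h₂ : IsApproximable g₂) : IsApproximable (g₁ * g₂) := by
  intro H hH
  obtain ⟨γ₂, k₂, hk₂, rfl⟩ := h₂ H hH
  obtain ⟨γ₁, k₁, hk₁, rfl⟩ := h₁ _ (hH.comap_conj (rationalFin γ₂)⁻¹)
  refine ⟨γ₁ * γ₂, _, mul_mem hk₁ hk₂, ?_⟩
  change _ = rationalFin (γ₁ * γ₂) * ((rationalFin γ₂)⁻¹ * k₁ * ((rationalFin γ₂)⁻¹)⁻¹ * k₂)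
  rw [map_mul]
  group

theorem isApproximable_rationalFin (γ : GL (Fin 2) F) : IsApproximable (rationalFin γ) :=
  fun H _ => ⟨γ, 1, one_mem H, (mul_one _).symm⟩

theorem isApproximable_nMat (x : FinAdele F) : IsApproximable (nMat x) := by
  rintro H ⟨e, he, hH⟩
  obtain ⟨a, ha⟩ := exists_valued_sub_le x he
  refine ⟨nMat a, nMat (x - algebraMap F _ a), hH _ (by simp) fun p i j => ?_, ?_⟩
  · have hval : (nMat (x - algebraMap F (FinAdele F) a)).val - 1
        = !![0, x - algebraMap F (FinAdele F) a; 0, 0] := by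
      rw [val_nMat, Matrix.one_fin_two]
      ext i j : 2
      fin_cases i <;> fin_cases j <;> simp
    rw [hval]
    fin_cases i <;> fin_cases j
    · simp
    · exact ha p
    · simp
    · simp
  · rw [rationalFin, map_nMat, ← nMat_add]
    congr 1
    ring

/-- The lower triangular unipotent matrix `(1 0; x 1)`. -/
noncomputable def nLower {R : Type*} [CommRing R] (x : R) : GL (Fin 2) R :=
  weyl * nMat (-x) * weyl⁻¹

theorem val_nLower {R : Type*} [CommRing R] (x : R) : (nLower x).val = !![1, 0; x, 1] := by
  have h : nLower x * weyl = weyl * nMat (-x) := by simp [nLower]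
  have h2 : (nLower x).val * !![0, 1; -1, 0] = !![0, 1; -1, x] := by
    have := congrArg Units.val h
    simpa using this
  calc (nLower x).val = (nLower x).val * (!![0, 1; -1, 0] * !![0, -1; 1, 0]) := by
        simp [← Matrix.one_fin_two]
    _ = _ := by
        rw [← mul_assoc, h2]
        simp

theorem isApproximable_nLower (x : FinAdele F) : IsApproximable (nLower x) := by
  have hw : rationalFin (F := F) weyl = weyl := map_weyl _
  refine ((hw ▸ isApproximable_rationalFin weyl).mul (isApproximable_nMat _)).mul ?_
  rw [← hw, ← map_inv]
  exact isApproximable_rationalFin _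

/-- Row and column operations with the unit pivot u turn both diagonal entries into 1; the
determinant then fixes the upper right entry. -/
theorem eq_unipotent_mul {R : Type*} [CommRing R] (g : GL (Fin 2) R) (hg : g.val.det = 1) (u : Rˣ)
    (hu : g.val 1 0 = u) :
    g = nMat ((g.val 0 0 - 1) * (u⁻¹ : Rˣ)) * nLower (u : R) *
      nMat ((g.val 1 1 - 1) * (u⁻¹ : Rˣ)) := by
  apply Units.ext
  rw [Matrix.det_fin_two, hu] at hg
  rw [Units.val_mul, Units.val_mul, val_nMat, val_nLower, val_nMat]
  have huu : (u : R) * (u⁻¹ : Rˣ) = 1 := Units.mul_inv u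
  generalize ((u⁻¹ : Rˣ) : R) = u' at huu
  rw [Matrix.eta_fin_two g.val, hu]
  set a := g.val 0 0
  set b := g.val 0 1
  set d := g.val 1 1
  generalize (u : R) = u₁ at *
  simp only [Matrix.mul_fin_two]
  refine Matrix.ext fun i j => ?_
  fin_cases i <;> fin_cases j
  · simp
    linear_combination (1 - a) * huu
  · simp
    linear_combination (-b - (a - 1) * (d - 1) * u') * huu - u' * hg
  · simp
  · simp
    linear_combination (1 - d) * huu

/-- **Strong approximation** for `SL₂`. -/
theorem isApproximable_of_det_eq_one {g : GL (Fin 2) (FinAdele F)} (hg : g.val.det = 1) :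
    IsApproximable g := by
  classical
  set c := g.val 1 0 with hc
  set d := g.val 1 1 with hd
  have hdet : ∀ p, g.val 0 0 p * d p - g.val 0 1 p * c p = 1 := by
    intro p
    have := congrArg (evalFin p) hg
    rw [Matrix.det_fin_two, map_sub, map_mul, map_mul, map_one] at this
    exact this
  -- Right multiplication by `nLower ε` replaces c by c + dε, which has to be an idele. With ε = 0
  -- or 1 it is nonzero everywhere, because c and d are not both 0.
  let ε : FinAdele F := ⟨fun p => if Valued.v (c p) = 1 ∨ c p + d p = 0 then 0 else 1, by
    refine Filter.Eventually.of_forall fun p => ?_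
    dsimp only
    split_ifs
    · exact zero_mem _
    · exact one_mem _⟩
  have hε : ∀ p, ε p = if Valued.v (c p) = 1 ∨ c p + d p = 0 then 0 else 1 := fun p => rfl
  have hunit : IsUnit (c + d * ε) := by
    rw [FiniteAdeleRing.isUnit_iff]
    constructor
    · intro p
      change c p + d p * ε p ≠ 0
      rw [hε]
      split_ifs with h
      · rw [mul_zero, add_zero]
        intro h0
        rcases h with h | h
        · rw [h0, map_zero] at h
          exact zero_ne_one h
        · have := hdet p
          rw [h0, zero_add] at h
          rw [h0, h] at this
          simp at this
      · rw [mul_one]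
        exact fun h' => h (Or.inr h')
    · filter_upwards [(g.val 0 0).2, (g.val 0 1).2, c.2, d.2] with p h1 h2 h3 h4
      change Valued.v (g.val 0 0 p) ≤ 1 at h1
      change Valued.v (g.val 0 1 p) ≤ 1 at h2
      change Valued.v (c p) ≤ 1 at h3
      change Valued.v (d p) ≤ 1 at h4
      change Valued.v (c p + d p * ε p) = 1
      by_cases hc1 : Valued.v (c p) = 1
      · rw [hε, if_pos (Or.inl hc1), mul_zero, add_zero, hc1]
      · have hclt : Valued.v (c p) < 1 := lt_of_le_of_ne h3 hc1
        -- All entries are integral at this prime, so |c| < 1 and determinant 1 make d a unit, and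
        -- then c + d is a unit too.
        have hd1 : Valued.v (d p) = 1 := by
          refine le_antisymm h4 ?_
          by_contra hlt
          rw [not_le] at hlt
          have h5 : Valued.v (g.val 0 0 p * d p - g.val 0 1 p * c p) < 1 := by
            refine (Valuation.map_sub _ _ _).trans_lt (max_lt ?_ ?_) <;> rw [map_mul]
            · exact mul_lt_one_of_nonneg_of_lt_one_right h1 zero_le hlt
            · exact mul_lt_one_of_nonneg_of_lt_one_right h2 zero_le hclt
          rw [hdet p, map_one] at h5
          exact lt_irrefl _ h5
        have hcd : Valued.v (c p + d p) = 1 := by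
          rw [Valuation.map_add_eq_of_lt_right _ (by rwa [hd1]), hd1]
        have hcd0 : c p + d p ≠ 0 := by
          intro h
          rw [h, map_zero] at hcd
          exact zero_ne_one hcd
        rw [hε, if_neg (by tauto), mul_one, hcd]
  obtain ⟨u, hu⟩ := hunit
  have hlow : (g * nLower ε).val 1 0 = u := by
    rw [Units.val_mul, val_nLower, Matrix.mul_apply, Fin.sum_univ_two, hu]
    simp [c, d]
  have hdet' : (g * nLower ε).val.det = 1 := by
    rw [Units.val_mul, Matrix.det_mul, hg, val_nLower]
    simp
  have h1 : g = g * nLower ε * nLower (-ε) := by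
    apply Units.ext
    simp only [Units.val_mul, val_nLower, mul_assoc]
    simp [← Matrix.one_fin_two]
  rw [h1, eq_unipotent_mul _ hdet' u hlow]
  exact (((isApproximable_nMat _).mul (isApproximable_nLower _)).mul
    (isApproximable_nMat _)).mul (isApproximable_nLower _)

/-- The decomposition of `GL₂(𝔸_fin)` along the class group. -/
theorem exists_eq_rationalFin_mul {θ : Fin (NumberField.classNumber F) → (FinAdele F)ˣ}
    (hθ : IsClassRepresentatives θ) {H : Subgroup (GL (Fin 2) (FinAdele F))}
    (hH : ContainsCongruence H)
    (hu : ∀ u : (FinAdele F)ˣ, (∀ p, Valued.v ((u : FinAdele F) p) = 1) → aMat u ∈ H)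
    (g : GL (Fin 2) (FinAdele F)) :
    ∃ γ : GL (Fin 2) F, ∃ i, ∃ h ∈ H, g = rationalFin γ * aMat (θ i) * h := by
  obtain ⟨i, α, hα⟩ := exists_class_representative hθ (Matrix.GeneralLinearGroup.det g)
  set δ := Matrix.GeneralLinearGroup.det g with hδ
  let α' : (FinAdele F)ˣ := Units.map (algebraMap F (FinAdele F) : F →* FinAdele F) α
  -- The determinant is α θ_i u with u a unit idele; stripping off a(α), a(θ_i) and a(u) leaves an
  -- element of SL₂.
  obtain ⟨u, hu'⟩ : ∃ u : (FinAdele F)ˣ, u = δ * (α' * θ i)⁻¹ := ⟨_, rfl⟩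
  have hαu : (aMat α' : GL (Fin 2) (FinAdele F)) = rationalFin (aMat α) := (map_aMat _ _).symm
  have hu1 : ∀ p, Valued.v ((u : FinAdele F) p) = 1 := by
    intro p
    have h1 : (u : FinAdele F) * (α' * θ i : (FinAdele F)ˣ) = δ := by
      rw [← Units.val_mul, hu', inv_mul_cancel_right]
    have h2 := congrArg (fun x => Valued.v (evalFin p x)) h1
    rw [map_mul, map_mul, Units.val_mul, map_mul, map_mul] at h2
    have h3 : Valued.v (evalFin p (δ : FinAdele F)) = Valued.v (evalFin p (α' : FinAdele F)) *
      Valued.v (evalFin p (θ i : FinAdele F)) := hα p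
    rw [h3] at h2
    refine (mul_eq_right₀ ?_).1 h2
    rw [← h3, Valuation.ne_zero_iff]
    exact (FiniteAdeleRing.isUnit_iff.1 δ.isUnit).1 p
  have hdet : ((aMat α')⁻¹ * g * (aMat u)⁻¹ * (aMat (θ i))⁻¹).val.det = 1 := by
    have h : Matrix.GeneralLinearGroup.det ((aMat α')⁻¹ * g * (aMat u)⁻¹ * (aMat (θ i))⁻¹) = 1 := by
      have ha : ∀ y : (FinAdele F)ˣ, Matrix.GeneralLinearGroup.det (aMat y) = y := by
        intro y
        apply Units.ext
        exact det_val_aMat y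
      simp only [map_mul, map_inv, ha, ← hδ, hu']
      simp [mul_comm, mul_left_comm]
    exact congrArg Units.val h
  -- The error is taken in a conjugate of H, so that it lies in H after passing to the right of
  -- a(θ_i).
  obtain ⟨γ, h, hh, hγ⟩ := isApproximable_of_det_eq_one hdet _ (hH.comap_conj (aMat (θ i))⁻¹)
  refine ⟨aMat α * γ, i, _, mul_mem hh (hu u hu1), ?_⟩
  change g = _ * _ * ((aMat (θ i))⁻¹ * h * ((aMat (θ i))⁻¹)⁻¹ * aMat u)
  rw [map_mul, ← hαu]
  have h2 : g = aMat α' * ((aMat α')⁻¹ * g * (aMat u)⁻¹ * (aMat (θ i))⁻¹) *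
      aMat (θ i) * aMat u := by
    group
  rw [h2, hγ]
  group

end StrongApproximation

/-! ### The archimedean places -/

section Archimedean

variable {F : Type*} [Field F] [NumberField F] {v : InfinitePlace F}

open InfinitePlace.Completion

/-- At a real place the embedding has real values, fixed by conjugation; at a complex place it is
onto. This supplies the conjugates needed for a unitary matrix over F_ν. -/
theorem exists_extensionEmbedding_eq_conj (c : v.Completion) :
    ∃ c' : v.Completion, extensionEmbedding v c' = star (extensionEmbedding v c) := by
  rcases v.isReal_or_isComplex with hv | hv
  · refine ⟨c, ?_⟩
    rw [← extensionEmbeddingOfIsReal_apply hv]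
    exact (Complex.conj_ofReal _).symm
  · exact surjective_extensionEmbedding_of_isComplex hv _

theorem exists_extensionEmbedding_eq_ofReal (v : InfinitePlace F) (r : ℝ) :
    ∃ c : v.Completion, extensionEmbedding v c = r := by
  rcases v.isReal_or_isComplex with hv | hv
  · obtain ⟨c, hc⟩ := surjective_extensionEmbeddingOfIsReal hv r
    refine ⟨c, ?_⟩
    rw [← extensionEmbeddingOfIsReal_apply hv, hc]
  · exact surjective_extensionEmbedding_of_isComplex hv _

theorem norm_extensionEmbedding (c : v.Completion) : ‖extensionEmbedding v c‖ = ‖c‖ := by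
  simpa using (isometry_extensionEmbedding v).dist_eq c 0

theorem mem_KInf {k : GL (Fin 2) v.Completion} :
    k ∈ KInf v ↔ k.val.map (extensionEmbedding v) ∈ Matrix.unitaryGroup (Fin 2) ℂ := Iff.rfl

/-- The group `Z(F_ν) K_ν`. -/
noncomputable def ZKInf (v : InfinitePlace F) : Subgroup (GL (Fin 2) v.Completion) where
  carrier := {g | ∃ z : v.Completionˣ, ∃ k ∈ KInf v, g = zMat z * k}
  one_mem' := ⟨1, 1, by simp [KInf, one_mem], by rw [zMat_one, one_mul]⟩
  mul_mem' := by
    rintro _ _ ⟨z, k, hk, rfl⟩ ⟨z', k', hk', rfl⟩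
    refine ⟨z * z', k * k', ?_, zMat_mul_mul _ _ _ _⟩
    rw [mem_KInf, Units.val_mul, Matrix.map_mul]
    exact mul_mem hk hk'
  inv_mem' := by
    rintro _ ⟨z, k, hk, rfl⟩
    refine ⟨z⁻¹, k⁻¹, ?_, zMat_mul_inv _ _⟩
    have h1 : (k.val.map (extensionEmbedding v)) * (k⁻¹.val.map (extensionEmbedding v)) = 1 := by
      rw [← Matrix.map_mul, ← Units.val_mul, mul_inv_cancel]
      simp
    have h2 : star (k.val.map (extensionEmbedding v)) = k⁻¹.val.map (extensionEmbedding v) := by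
      calc star (k.val.map (extensionEmbedding v))
          = star (k.val.map (extensionEmbedding v)) * ((k.val.map (extensionEmbedding v)) *
            (k⁻¹.val.map (extensionEmbedding v))) := by rw [h1, mul_one]
        _ = _ := by rw [← mul_assoc, (Matrix.mem_unitaryGroup_iff').1 hk, one_mul]
    rw [mem_KInf, ← h2]
    exact Unitary.star_mem hk

theorem norm_sq_add_norm_sq_pos (g : GL (Fin 2) v.Completion) :
    0 < ‖g.val 1 0‖ ^ 2 + ‖g.val 1 1‖ ^ 2 := by
  have hdet := det_val_ne_zero g
  rw [Matrix.det_fin_two] at hdet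
  by_cases hc : g.val 1 0 = 0
  · have hd : g.val 1 1 ≠ 0 := by
      intro h
      rw [hc, h] at hdet
      simp at hdet
    positivity
  · positivity

/-- The Iwasawa decomposition at an archimedean place. -/
theorem exists_eq_bMat_mul (g : GL (Fin 2) v.Completion) :
    ∃ (y : v.Completionˣ) (x : v.Completion), (bMat y x)⁻¹ * g ∈ ZKInf v := by
  set σ := extensionEmbedding v with hσ
  set a := g.val 0 0 with ha
  set b := g.val 0 1 with hb
  set c := g.val 1 0 with hc
  set d := g.val 1 1 with hd
  have hpos : 0 < ‖c‖ ^ 2 + ‖d‖ ^ 2 := norm_sq_add_norm_sq_pos g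
  have hdet : a * d - b * c ≠ 0 := by
    have := det_val_ne_zero g
    rwa [Matrix.det_fin_two] at this
  obtain ⟨c', hc'⟩ := exists_extensionEmbedding_eq_conj c
  obtain ⟨d', hd'⟩ := exists_extensionEmbedding_eq_conj d
  set r := Real.sqrt (‖c‖ ^ 2 + ‖d‖ ^ 2) with hr
  have hr0 : 0 < r := Real.sqrt_pos.2 hpos
  have hr2 : r ^ 2 = ‖c‖ ^ 2 + ‖d‖ ^ 2 := Real.sq_sqrt hpos.le
  obtain ⟨ρ, hρ⟩ := exists_extensionEmbedding_eq_ofReal v r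
  rw [← hσ] at hc' hd' hρ
  have hsq : ∀ w : v.Completion, σ w * star (σ w) = ((‖w‖ ^ 2 : ℝ) : ℂ) := by
    intro w
    rw [← norm_extensionEmbedding w]
    push_cast
    exact RCLike.mul_conj _
  have hρ2 : ρ ^ 2 = c * c' + d * d' := by
    apply σ.injective
    rw [map_pow, map_add, map_mul, map_mul, hc', hd', hsq, hsq, hρ, ← Complex.ofReal_add, ← hr2]
    push_cast
    rfl
  have hρ0 : ρ ≠ 0 := by
    intro h
    rw [h, map_zero] at hρ
    exact hr0.ne (by exact_mod_cast hρ)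
  -- The lower row of g scaled to length 1, completed by the orthogonal unit row that makes the
  -- determinant 1.
  let k : GL (Fin 2) v.Completion :=
    Matrix.GeneralLinearGroup.mkOfDetNeZero !![d' / ρ, -c' / ρ; c / ρ, d / ρ] (by
      have : (!![d' / ρ, -c' / ρ; c / ρ, d / ρ]).det = 1 := by
        rw [Matrix.det_fin_two_of]
        field_simp
        rw [hρ2]
        ring
      rw [this]
      exact one_ne_zero)
  have hk : k.val = !![d' / ρ, -c' / ρ; c / ρ, d / ρ] := rfl
  -- The scalar ρ is the length of the lower row; y comes from comparing determinants and x from the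
  -- inner product of the two rows of g.
  refine ⟨Units.mk0 ((a * d - b * c) / ρ ^ 2) (by positivity), (a * c' + b * d') / ρ ^ 2,
    Units.mk0 ρ hρ0, k, ?_, ?_⟩
  · have hmap : k.val.map σ = !![star (σ d) / r, -star (σ c) / r; σ c / r, σ d / r] := by
      rw [hk]
      refine Matrix.ext fun i j => ?_
      fin_cases i <;> fin_cases j <;> simp [hc', hd', hρ]
    have hrC : (r : ℂ) ≠ 0 := by exact_mod_cast hr0.ne'
    have hsum : σ c * star (σ c) + σ d * star (σ d) = (r : ℂ) ^ 2 := by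
      rw [hsq, hsq, ← Complex.ofReal_add, ← hr2]
      push_cast
      rfl
    rw [mem_KInf, ← hσ, hmap, Matrix.mem_unitaryGroup_iff]
    have hstar : star (!![star (σ d) / r, -star (σ c) / r; σ c / r, σ d / r] :
        Matrix (Fin 2) (Fin 2) ℂ) = !![σ d / r, star (σ c) / r; -σ c / r, star (σ d) / r] := by
      refine Matrix.ext fun i j => ?_
      fin_cases i <;> fin_cases j <;> simp [Matrix.star_apply]
    rw [hstar, Matrix.mul_fin_two, Matrix.one_fin_two]
    refine Matrix.ext fun i j => ?_
    fin_cases i <;> fin_cases j <;> simp <;> field_simp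
    · rw [← hsum, mul_comm, mul_comm _ (σ c), add_comm]
      rfl
    · ring
    · ring
    · exact hsum
  · rw [inv_mul_eq_iff_eq_mul]
    apply Units.ext
    simp only [Units.val_mul, val_zMat, val_bMat, hk, Units.val_mk0]
    rw [Matrix.eta_fin_two g.val, ← ha, ← hb, ← hc, ← hd]
    simp only [Matrix.mul_fin_two]
    refine Matrix.ext fun i j => ?_
    fin_cases i <;> fin_cases j
    · simp
      field_simp
      rw [hρ2]
      ring
    · simp
      field_simp
      rw [hρ2]
      ring
    · simp
      field_simp
    · simp
      field_simp

end Archimedean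

/-! ### The group `K^*` -/

section KStar

variable {F : Type*} [Field F] [NumberField F]

/-- The group `Z(F_𝔭) K_𝔭`. -/
noncomputable def ZKFin (p : HeightOneSpectrum (𝓞 F)) :
    Subgroup (GL (Fin 2) (p.adicCompletion F)) where
  carrier := {g | ∃ z : (p.adicCompletion F)ˣ, ∃ k ∈ KFin p, g = zMat z * k}
  one_mem' := ⟨1, 1, one_mem _, by rw [zMat_one, one_mul]⟩
  mul_mem' := by
    rintro _ _ ⟨z, k, hk, rfl⟩ ⟨z', k', hk', rfl⟩
    exact ⟨z * z', k * k', mul_mem hk hk', zMat_mul_mul _ _ _ _⟩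
  inv_mem' := by
    rintro _ ⟨z, k, hk, rfl⟩
    exact ⟨z⁻¹, k⁻¹, inv_mem hk, zMat_mul_inv _ _⟩

theorem KFin_le_ZKFin (p : HeightOneSpectrum (𝓞 F)) : KFin p ≤ ZKFin p :=
  fun k hk => ⟨1, k, hk, by rw [zMat_one, one_mul]⟩

open Classical in
/-- The local component of `K^*` at a finite place. -/
noncomputable def localStar (ϖ : Uniformizers F) (𝔞 : Ideal (𝓞 F)) (p : HeightOneSpectrum (𝓞 F)) :
    Subgroup (GL (Fin 2) (p.adicCompletion F)) :=
  if p.asIdeal ∣ 𝔞 then Subgroup.closure (K0Fin p 1 ∪ {antiMat (ϖ.unit p)}) else ZKFin p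

variable (ϖ : Uniformizers F) (𝔞 : Ideal (𝓞 F))

theorem mem_KStar_iff {g : GL (Fin 2) (Adele F)} : g ∈ KStar ϖ 𝔞 ↔
    (∀ v, compInf v g ∈ ZKInf v) ∧ ∀ p, compFin p (finPart g) ∈ localStar ϖ 𝔞 p := by
  refine and_congr Iff.rfl ⟨?_, ?_⟩
  · rintro ⟨h1, h2⟩ p
    unfold localStar
    split_ifs with h
    · exact h2 p h
    · exact h1 p h
  · intro h
    refine ⟨fun p hp => ?_, fun p hp => ?_⟩
    · have := h p
      rwa [localStar, if_neg hp] at this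
    · have := h p
      rwa [localStar, if_pos hp] at this

theorem mul_mem_KStar {g h : GL (Fin 2) (Adele F)} (hg : g ∈ KStar ϖ 𝔞) (hh : h ∈ KStar ϖ 𝔞) :
    g * h ∈ KStar ϖ 𝔞 := by
  rw [mem_KStar_iff] at *
  refine ⟨fun v => ?_, fun p => ?_⟩
  · rw [map_mul]
    exact mul_mem (hg.1 v) (hh.1 v)
  · rw [map_mul, map_mul]
    exact mul_mem (hg.2 p) (hh.2 p)

theorem inv_mem_KStar {g : GL (Fin 2) (Adele F)} (hg : g ∈ KStar ϖ 𝔞) : g⁻¹ ∈ KStar ϖ 𝔞 := by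
  rw [mem_KStar_iff] at *
  refine ⟨fun v => ?_, fun p => ?_⟩
  · rw [map_inv]
    exact inv_mem (hg.1 v)
  · rw [map_inv, map_inv]
    exact inv_mem (hg.2 p)

theorem one_mem_KStar : 1 ∈ KStar ϖ 𝔞 := by
  rw [mem_KStar_iff]
  refine ⟨fun v => ?_, fun p => ?_⟩
  · rw [map_one]
    exact one_mem _
  · rw [map_one, map_one]
    exact one_mem _

/-- The finite part of `K^*`. -/
noncomputable def finStar : Subgroup (GL (Fin 2) (FinAdele F)) :=
  ⨅ p, (localStar ϖ 𝔞 p).comap (compFin p)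

theorem mem_finStar {g : GL (Fin 2) (FinAdele F)} :
    g ∈ finStar ϖ 𝔞 ↔ ∀ p, compFin p g ∈ localStar ϖ 𝔞 p := by
  simp [finStar, Subgroup.mem_iInf]

theorem mem_localStar_of_mem_K0Fin {p : HeightOneSpectrum (𝓞 F)}
    {g : GL (Fin 2) (p.adicCompletion F)} (hg : g ∈ K0Fin p 1) : g ∈ localStar ϖ 𝔞 p := by
  unfold localStar
  split_ifs
  · exact Subgroup.subset_closure (Or.inl hg)
  · exact KFin_le_ZKFin p hg.1

theorem containsCongruence_finStar {𝔞 : Ideal (𝓞 F)} (h𝔞 : 𝔞 ≠ 0) :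
    ContainsCongruence (finStar ϖ 𝔞) := by
  classical
  refine ⟨fun p => if p.asIdeal ∣ 𝔞 then 1 else 0, ?_, fun g hg1 hg => ?_⟩
  · rw [Filter.eventually_cofinite]
    refine (finite_setOf_dvd h𝔞).subset fun p hp => ?_
    by_contra h
    exact hp (if_neg h)
  · rw [mem_finStar]
    intro p
    have hle : ∀ i j, Valued.v ((compFin p g).val i j) ≤ 1 := by
      intro i j
      have h1 : (compFin p g).val i j = evalFin p ((g.val - 1) i j)
          + evalFin p ((1 : Matrix (Fin 2) (Fin 2) (FinAdele F)) i j) := by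
        rw [← map_add, ← Matrix.add_apply, sub_add_cancel]
        rfl
      rw [h1]
      refine (Valuation.map_add _ _ _).trans (max_le ((hg p i j).trans ?_) ?_)
      · rw [← WithZero.exp_zero, WithZero.exp_le_exp]
        omega
      · fin_cases i <;> fin_cases j <;> simp
    have hK : compFin p g ∈ KFin p := by
      refine mem_KFin_iff.2 ⟨hle, ?_⟩
      have : (compFin p g).val.det = evalFin p g.val.det := by
        rw [RingHom.map_det]
        rfl
      rw [this, hg1, map_one, map_one]
    by_cases hp : p.asIdeal ∣ 𝔞
    · refine mem_localStar_of_mem_K0Fin ϖ 𝔞 ⟨hK, ?_⟩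
      have := hg p 1 0
      simpa [hp, compFin] using this
    · rw [localStar, if_neg hp]
      exact KFin_le_ZKFin p hK

/-- The determinants of the finite part of K^* thus include all unit ideles, as the decomposition
along the class group requires. -/
theorem aMat_mem_finStar (u : (FinAdele F)ˣ) (hu : ∀ p, Valued.v ((u : FinAdele F) p) = 1) :
    aMat u ∈ finStar ϖ 𝔞 := by
  rw [mem_finStar]
  intro p
  have hup : Valued.v (evalFin p (u : FinAdele F)) = 1 := hu p
  rw [compFin, map_aMat]
  refine mem_localStar_of_mem_K0Fin ϖ 𝔞 ⟨mem_KFin_iff.2 ⟨fun i j => ?_, ?_⟩, ?_⟩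
  · fin_cases i <;> fin_cases j <;> simp [hup]
  · rw [det_val_aMat]
    exact hup
  · simp

end KStar

/-! ### Components of adelic matrices -/

section Components

variable {F : Type*} [Field F] [NumberField F]

/-- The projection of `F_∞` to `F_ν`. -/
def evalArch (v : InfinitePlace F) : InfiniteAdeleRing F →+* v.Completion where
  toFun a := a v
  map_one' := rfl
  map_mul' _ _ := rfl
  map_zero' := rfl
  map_add' _ _ := rfl

theorem compInf_glPair (v : InfinitePlace F) (b : GL (Fin 2) (InfiniteAdeleRing F))
    (g : GL (Fin 2) (FinAdele F)) :
    compInf v (glPair b g) = Matrix.GeneralLinearGroup.map (evalArch v) b := rfl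

theorem finPart_glPair (b : GL (Fin 2) (InfiniteAdeleRing F)) (g : GL (Fin 2) (FinAdele F)) :
    finPart (glPair b g) = g := rfl

/-- The element of `F_∞` with given components. -/
def archMk (x : ∀ v : InfinitePlace F, v.Completion) : InfiniteAdeleRing F := x

theorem archMk_apply (x : ∀ v : InfinitePlace F, v.Completion) (v : InfinitePlace F) :
    archMk x v = x v := rfl

/-- The element of `F_∞ˣ` with given components. -/
def archUnit (y : ∀ v : InfinitePlace F, v.Completionˣ) : (InfiniteAdeleRing F)ˣ where
  val := archMk fun v => (y v).val
  inv := archMk fun v => (y v).inv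
  val_inv := by
    refine funext fun v => ?_
    exact (y v).val_inv
  inv_val := by
    refine funext fun v => ?_
    exact (y v).inv_val

theorem map_evalArch_archUnit (y : ∀ v : InfinitePlace F, v.Completionˣ) (v : InfinitePlace F) :
    Units.map (evalArch v : InfiniteAdeleRing F →* v.Completion) (archUnit y) = y v := by
  apply Units.ext
  rfl

theorem compInf_special (θ : Fin (NumberField.classNumber F) → (FinAdele F)ˣ)
    (y : (InfiniteAdeleRing F)ˣ) (x : InfiniteAdeleRing F) (i : Fin (NumberField.classNumber F))
    (v : InfinitePlace F) : compInf v (special θ y x i) =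
      bMat (Units.map (evalArch v : InfiniteAdeleRing F →* v.Completion) y) (x v) := by
  rw [special, compInf_glPair, map_bMat]
  rfl

theorem finPart_special (θ : Fin (NumberField.classNumber F) → (FinAdele F)ˣ)
    (y : (InfiniteAdeleRing F)ˣ) (x : InfiniteAdeleRing F) (i : Fin (NumberField.classNumber F)) :
    finPart (special θ y x i) = aMat (θ i) := rfl

variable (ϖ : Uniformizers F) {θ : Fin (NumberField.classNumber F) → (FinAdele F)ˣ}

/-- Every double coset in `GL₂(F) \ GL₂(𝔸_F) / K^*` contains a special matrix. -/
theorem exists_eq_rational_mul_special (hθ : IsClassRepresentatives θ) {𝔞 : Ideal (𝓞 F)}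
    (h𝔞 : 𝔞 ≠ 0) (g : GL (Fin 2) (Adele F)) :
    ∃ γ y x i, ∃ k ∈ KStar ϖ 𝔞, g = rational γ * special θ y x i * k := by
  obtain ⟨γ, i, h, hh, hg⟩ := exists_eq_rationalFin_mul hθ (containsCongruence_finStar ϖ h𝔞)
    (aMat_mem_finStar ϖ 𝔞) (finPart g)
  -- γ is fixed by the finite places; y and x then come from the Iwasawa decomposition of γ⁻¹g at
  -- each archimedean place.
  choose y x hyx using fun v => exists_eq_bMat_mul (compInf v ((rational γ)⁻¹ * g))
  refine ⟨γ, archUnit y, archMk x, i,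
    (special θ (archUnit y) (archMk x) i)⁻¹ * ((rational γ)⁻¹ * g), ?_, by group⟩
  rw [mem_KStar_iff]
  refine ⟨fun v => ?_, ?_⟩
  · rw [map_mul, map_inv, compInf_special, map_evalArch_archUnit, archMk_apply]
    exact hyx v
  · rw [← mem_finStar]
    rw [map_mul, map_inv, finPart_special, map_mul, map_inv, finPart_rational, hg]
    convert hh using 1
    group

end Components

/-! ### Heights of bottom rows: the finite places -/

section FiniteHeights

variable {F : Type*} [Field F] [NumberField F] {p : HeightOneSpectrum (𝓞 F)}

theorem norm_le_norm_iff {x y : p.adicCompletion F} :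
    ‖x‖ ≤ ‖y‖ ↔ Valued.v x ≤ Valued.v y := by
  rw [FinitePlace.norm_def, FinitePlace.norm_def, NNReal.coe_le_coe,
    (WithZeroMulInt.toNNReal_strictMono
      (NumberField.HeightOneSpectrum.one_lt_absNorm_nnreal p)).le_iff_le]

theorem norm_le_one_iff_valued {x : p.adicCompletion F} : ‖x‖ ≤ 1 ↔ Valued.v x ≤ 1 := by
  rw [← norm_one (α := p.adicCompletion F), norm_le_norm_iff, map_one]

theorem norm_eq_norm_iff {x y : p.adicCompletion F} :
    ‖x‖ = ‖y‖ ↔ Valued.v x = Valued.v y := by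
  rw [le_antisymm_iff, le_antisymm_iff, norm_le_norm_iff, norm_le_norm_iff]

theorem norm_eq_one_iff_valued {x : p.adicCompletion F} : ‖x‖ = 1 ↔ Valued.v x = 1 := by
  rw [← norm_one (α := p.adicCompletion F), norm_eq_norm_iff, map_one]

/-- If both entries of the lower row were in the maximal ideal, so would be the determinant. -/
theorem norm_det_of_mem_KFin {u : GL (Fin 2) (p.adicCompletion F)} (hu : u ∈ KFin p) :
    ‖u.val.det‖ = 1 ∧ max ‖u.val 1 0‖ ‖u.val 1 1‖ = 1 := by
  obtain ⟨h1, h2⟩ := mem_KFin_iff.1 hu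
  refine ⟨norm_eq_one_iff_valued.2 h2, le_antisymm
    (max_le (norm_le_one_iff_valued.2 (h1 _ _)) (norm_le_one_iff_valued.2 (h1 _ _))) ?_⟩
  by_contra! h
  rw [max_lt_iff] at h
  have h3 : ∀ j, Valued.v (u.val 1 j) < 1 := by
    intro j
    rw [← not_le, ← map_one (Valued.v (R := p.adicCompletion F)), ← norm_le_norm_iff, not_le,
      norm_one]
    fin_cases j
    · exact h.1
    · exact h.2
  refine h2.not_lt ?_
  rw [Matrix.det_fin_two]
  refine (Valuation.map_sub _ _ _).trans_lt (max_lt ?_ ?_) <;> rw [map_mul]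
  · exact (mul_le_of_le_one_left zero_le (h1 _ _)).trans_lt (h3 _)
  · exact (mul_le_of_le_one_left zero_le (h1 _ _)).trans_lt (h3 _)

/-- The ratio of |det| to the squared maximum of the lower row is invariant under scalars and equals
1 on K_𝔭. For u (0 1; ϖ 0) with u in K₀(1) the lower row (u₁₁ϖ, u₁₀) has maximum |ϖ| and the
determinant has norm |ϖ|, which gives |ϖ|⁻¹. -/
theorem norm_det_of_mem_localStar (ϖ : Uniformizers F) {𝔞 : Ideal (𝓞 F)}
    {k : GL (Fin 2) (p.adicCompletion F)} (hk : k ∈ localStar ϖ 𝔞 p) :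
    ‖k.val.det‖ = max ‖k.val 1 0‖ ‖k.val 1 1‖ ^ 2 ∨
      p.asIdeal ∣ 𝔞 ∧ ‖k.val.det‖ =
        max ‖k.val 1 0‖ ‖k.val 1 1‖ ^ 2 * ‖(ϖ.unit p : p.adicCompletion F)‖⁻¹ := by
  have key : ∀ (z : (p.adicCompletion F)ˣ), ∀ u ∈ KFin p, ‖(zMat z * u).val.det‖ =
      max ‖(zMat z * u).val 1 0‖ ‖(zMat z * u).val 1 1‖ ^ 2 := by
    intro z u hu
    obtain ⟨h1, h2⟩ := norm_det_of_mem_KFin hu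
    have e : ∀ j, (zMat z * u).val 1 j = z * u.val 1 j := by
      intro j
      simp [Units.val_mul, Matrix.mul_apply, Fin.sum_univ_two]
    rw [e, e, norm_mul, norm_mul, ← mul_max_of_nonneg _ _ (norm_nonneg _), h2, Units.val_mul,
      Matrix.det_mul, norm_mul, h1, val_zMat, Matrix.det_fin_two]
    simp [sq]
  unfold localStar at hk
  split_ifs at hk with hp
  · obtain ⟨z, u, hu, rfl | rfl⟩ := exists_of_mem_closure ϖ hk
    · exact Or.inl (key z u hu.1)
    · refine Or.inr ⟨hp, ?_⟩
      have e0 : (zMat z * u * antiMat (ϖ.unit p)).val 1 0 = z * (u.val 1 1 * ϖ.unit p) := by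
        simp [Units.val_mul, Matrix.mul_apply, Fin.sum_univ_two, mul_assoc]
      have e1 : (zMat z * u * antiMat (ϖ.unit p)).val 1 1 = z * u.val 1 0 := by
        rw [Units.val_mul, Units.val_mul, Matrix.mul_apply, Fin.sum_univ_two, Matrix.mul_apply,
          Fin.sum_univ_two]
        simp
      have e2 : (zMat z * u * antiMat (ϖ.unit p)).val.det = -(z * z * u.val.det * ϖ.unit p) := by
        rw [Units.val_mul, Units.val_mul, Matrix.det_mul, Matrix.det_mul, val_zMat, val_antiMat,
          Matrix.det_fin_two_of, Matrix.det_fin_two_of]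
        ring
      have h11 : ‖u.val 1 1‖ = 1 := norm_eq_one_iff_valued.2 (valued_diag_of_mem_K0Fin le_rfl hu).2
      have h10 : ‖u.val 1 0‖ ≤ ‖(ϖ.unit p : p.adicCompletion F)‖ := by
        rw [norm_le_norm_iff, valued_unit]
        exact hu.2
      have h0 : ‖(ϖ.unit p : p.adicCompletion F)‖ ≠ 0 := norm_ne_zero_iff.2 (ϖ.unit p).ne_zero
      rw [e0, e1, e2, norm_neg, norm_mul, norm_mul, norm_mul, norm_mul, norm_mul, norm_mul,
        (norm_det_of_mem_KFin hu.1).1, h11, one_mul, ← mul_max_of_nonneg _ _ (norm_nonneg _),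
        max_eq_left h10]
      field_simp
  · obtain ⟨z, u, hu, rfl⟩ := hk
    exact Or.inl (key z u hu)

theorem norm_det_of_mul_eq_aMat (ϖ : Uniformizers F) {𝔞 : Ideal (𝓞 F)}
    {h k : GL (Fin 2) (p.adicCompletion F)} {t : (p.adicCompletion F)ˣ}
    (hk : k ∈ localStar ϖ 𝔞 p) (hhk : h * k = aMat t) :
    ‖h.val.det‖ = ‖(t : p.adicCompletion F)‖ * max ‖h.val 1 0‖ ‖h.val 1 1‖ ^ 2 ∨
      p.asIdeal ∣ 𝔞 ∧ ‖h.val.det‖ = ‖(t : p.adicCompletion F)‖ * max ‖h.val 1 0‖ ‖h.val 1 1‖ ^ 2 *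
        ‖(ϖ.unit p : p.adicCompletion F)‖⁻¹ := by
  obtain ⟨k', hk', rfl⟩ : ∃ k' ∈ localStar ϖ 𝔞 p, h = aMat t * k' :=
    ⟨k⁻¹, inv_mem hk, by rw [← hhk, mul_inv_cancel_right]⟩
  have e : ∀ j, (aMat t * k').val 1 j = k'.val 1 j := by
    intro j
    simp [Units.val_mul, Matrix.mul_apply, Fin.sum_univ_two]
  rw [e, e, Units.val_mul, Matrix.det_mul, det_val_aMat, norm_mul]
  rcases norm_det_of_mem_localStar ϖ hk' with h1 | ⟨hp, h1⟩
  · exact Or.inl (by rw [h1])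
  · exact Or.inr ⟨hp, by rw [h1, mul_assoc]⟩

end FiniteHeights

/-! ### Heights of bottom rows: the archimedean places -/

section ArchimedeanHeights

variable {F : Type*} [Field F] [NumberField F] {v : InfinitePlace F}

open InfinitePlace.Completion

/-- A unitary matrix has determinant of modulus 1 and lower row of length 1, and both sides scale by
|z|². -/
theorem norm_det_of_mem_ZKInf {k : GL (Fin 2) v.Completion} (hk : k ∈ ZKInf v) :
    ‖k.val.det‖ = ‖k.val 1 0‖ ^ 2 + ‖k.val 1 1‖ ^ 2 := by
  obtain ⟨z, u, hu, rfl⟩ := hk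
  have e : ∀ j, (zMat z * u).val 1 j = z * u.val 1 j := by
    intro j
    simp [Units.val_mul, Matrix.mul_apply, Fin.sum_univ_two]
  rw [mem_KInf] at hu
  set σ := extensionEmbedding v with hσ
  have hdet : ‖u.val.det‖ = 1 := by
    rw [← norm_extensionEmbedding, RingHom.map_det]
    have := Matrix.det_of_mem_unitary hu
    exact CStarRing.norm_of_mem_unitary this
  have hrow : ‖u.val 1 0‖ ^ 2 + ‖u.val 1 1‖ ^ 2 = 1 := by
    have h1 := congrFun (congrFun (Matrix.mem_unitaryGroup_iff.1 hu) 1) 1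
    rw [Matrix.mul_apply, Fin.sum_univ_two] at h1
    simp only [Matrix.star_apply, Matrix.map_apply, Matrix.one_apply_eq, RCLike.star_def,
      RCLike.mul_conj] at h1
    rw [hσ, norm_extensionEmbedding, norm_extensionEmbedding] at h1
    apply Complex.ofReal_injective
    push_cast
    exact h1
  rw [e, e, norm_mul, norm_mul, mul_pow, mul_pow, ← mul_add, hrow, Units.val_mul,
    Matrix.det_mul, norm_mul, hdet, val_zMat, Matrix.det_fin_two]
  simp [sq]

theorem norm_det_of_mul_eq_bMat {h k : GL (Fin 2) v.Completion} {y : v.Completionˣ}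
    {x : v.Completion} (hk : k ∈ ZKInf v) (hhk : h * k = bMat y x) :
    ‖h.val.det‖ = ‖(y : v.Completion)‖ * (‖h.val 1 0‖ ^ 2 + ‖h.val 1 1‖ ^ 2) := by
  obtain ⟨k', hk', rfl⟩ : ∃ k' ∈ ZKInf v, h = bMat y x * k' :=
    ⟨k⁻¹, inv_mem hk, by rw [← hhk, mul_inv_cancel_right]⟩
  have e : ∀ j, (bMat y x * k').val 1 j = k'.val 1 j := by
    intro j
    simp [Units.val_mul, Matrix.mul_apply, Fin.sum_univ_two]
  rw [e, e, Units.val_mul, Matrix.det_mul, norm_mul, norm_det_of_mem_ZKInf hk']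
  simp [Matrix.det_fin_two]

end ArchimedeanHeights

/-! ### The maximum of the height in a double coset -/

section Maximum

variable {F : Type*} [Field F] [NumberField F]

/-- The embedding of `F` in its completion at an archimedean place. -/
noncomputable def embArch (v : InfinitePlace F) : F →+* v.Completion :=
  (evalArch v).comp (algebraMap F (InfiniteAdeleRing F))

theorem norm_embArch (v : InfinitePlace F) (a : F) : ‖embArch v a‖ = v a :=
  InfinitePlace.Completion.norm_coe v _

theorem hasFiniteMulSupport_norm_embedding {a : F} (ha : a ≠ 0) :
    (fun p : HeightOneSpectrum (𝓞 F) => ‖FinitePlace.embedding p a‖).HasFiniteMulSupport :=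
  (FinitePlace.hasFiniteMulSupport ha).comp_of_injective
    (FinitePlace.equivHeightOneSpectrum (K := F)).symm.injective

theorem prod_norm_embArch_mul_finprod {a : F} (ha : a ≠ 0) :
    (∏ v : InfinitePlace F, ‖embArch v a‖ ^ v.mult) *
      ∏ᶠ p : HeightOneSpectrum (𝓞 F), ‖FinitePlace.embedding p a‖ = 1 := by
  rw [← prod_abs_eq_one ha]
  congr 1
  · simp only [norm_embArch]
  · exact finprod_comp_equiv (f := fun w : FinitePlace F => w a)
      (FinitePlace.equivHeightOneSpectrum (K := F)).symm

theorem mulHeight₁_eq_finprod (a : F) :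
    Height.mulHeight₁ a = (∏ v : InfinitePlace F, max ‖embArch v a‖ 1 ^ v.mult) *
      ∏ᶠ p : HeightOneSpectrum (𝓞 F), max ‖FinitePlace.embedding p a‖ 1 := by
  rw [NumberField.mulHeight₁_eq]
  congr 1
  · simp only [norm_embArch]
  · exact (finprod_comp_equiv (f := fun w : FinitePlace F => max (w a) 1)
      (FinitePlace.equivHeightOneSpectrum (K := F)).symm).symm

theorem idele_apply_ne_zero (t : (FinAdele F)ˣ) (p : HeightOneSpectrum (𝓞 F)) :
    (t : FinAdele F) p ≠ 0 :=
  (t.isUnit.map (evalFin p)).ne_zero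

theorem hasFiniteMulSupport_norm_idele (t : (FinAdele F)ˣ) :
    (fun p : HeightOneSpectrum (𝓞 F) => ‖(t : FinAdele F) p‖).HasFiniteMulSupport := by
  have h := (FiniteAdeleRing.unitsEquiv_finite_valued_eq_one t)
  rw [Filter.eventually_cofinite] at h
  refine h.subset fun p hp h1 => hp ?_
  exact norm_eq_one_iff_valued.2 h1

theorem finprod_pos' {ι : Type*} {f : ι → ℝ} (hf : ∀ i, 0 < f i) : 0 < ∏ᶠ i, f i :=
  finprod_induction (fun x => 0 < x) one_pos (fun _ _ => mul_pos) hf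

/-- The modulus of a finite idele. -/
noncomputable def finModulus (t : (FinAdele F)ˣ) : ℝ :=
  ∏ᶠ p : HeightOneSpectrum (𝓞 F), ‖(t : FinAdele F) p‖

theorem finModulus_pos (t : (FinAdele F)ˣ) : 0 < finModulus t :=
  finprod_pos' fun p => norm_pos_iff.2 (idele_apply_ne_zero t p)

/-- The archimedean part of the height of the row `(r, s)` relative to `(y x; 0 1)`. -/
noncomputable def archHeight (y : (InfiniteAdeleRing F)ˣ) (x : InfiniteAdeleRing F) (r s : F) : ℝ :=
  ∏ v : InfinitePlace F, (‖embArch v r * (y : InfiniteAdeleRing F) v‖ ^ 2 +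
    ‖embArch v r * x v + embArch v s‖ ^ 2) ^ v.mult

/-- The finite part of the height of the row `(r, s)` relative to `a(t)`. -/
noncomputable def finHeight (t : (FinAdele F)ˣ) (r s : F) : ℝ :=
  ∏ᶠ p : HeightOneSpectrum (𝓞 F), max ‖FinitePlace.embedding p r * (t : FinAdele F) p‖
    ‖FinitePlace.embedding p s‖ ^ 2

open Classical in
/-- The contribution to the height of the places where `K^*` is used through `(0 1; ϖ 0)`. -/
noncomputable def levelFactor (ϖ : Uniformizers F) (S : Set (HeightOneSpectrum (𝓞 F))) : ℝ :=
  ∏ᶠ p : HeightOneSpectrum (𝓞 F), if p ∈ S then ‖(ϖ.unit p : p.adicCompletion F)‖⁻¹ else 1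

theorem one_le_levelFactor (ϖ : Uniformizers F) (S : Set (HeightOneSpectrum (𝓞 F))) :
    1 ≤ levelFactor ϖ S := by
  refine one_le_finprod fun p => ?_
  split_ifs
  · refine (one_le_inv₀ (norm_pos_iff.2 (ϖ.unit p).ne_zero)).2 (norm_le_one_iff_valued.2 ?_)
    rw [valued_unit, ← WithZero.exp_zero, WithZero.exp_le_exp]
    omega
  · exact le_rfl

variable (ϖ : Uniformizers F) {θ : Fin (NumberField.classNumber F) → (FinAdele F)ˣ}
  {𝔞 : Ideal (𝓞 F)}

/-- The product over all primes of the local relation `norm_det_of_mul_eq_aMat`. The scalar c is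
split off so that the lower row of γ can later be normalised to (0, 1) or (1, s). -/
theorem finModulus_eq_of_mul_eq (h𝔞 : 𝔞 ≠ 0) {γ : GL (Fin 2) F} {t t' : (FinAdele F)ˣ}
    {k : GL (Fin 2) (FinAdele F)} (hk : k ∈ finStar ϖ 𝔞)
    (h : rationalFin γ * aMat t * k = aMat t') {c r s : F} (hc : c ≠ 0)
    (hr : γ.val 1 0 = c * r) (hs : γ.val 1 1 = c * s) :
    ∃ S ⊆ {p : HeightOneSpectrum (𝓞 F) | p.asIdeal ∣ 𝔞},
      (∏ᶠ p : HeightOneSpectrum (𝓞 F), ‖FinitePlace.embedding p (γ.val.det / c ^ 2)‖) *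
        finModulus t = finModulus t' * finHeight t r s * levelFactor ϖ S := by
  classical
  have hδ : γ.val.det / c ^ 2 ≠ 0 := div_ne_zero (det_val_ne_zero γ) (pow_ne_zero 2 hc)
  have key : ∀ p : HeightOneSpectrum (𝓞 F), (fun e : ℝ =>
      ‖FinitePlace.embedding p (γ.val.det / c ^ 2)‖ * ‖(t : FinAdele F) p‖ =
        ‖(t' : FinAdele F) p‖ * max ‖FinitePlace.embedding p r * (t : FinAdele F) p‖
          ‖FinitePlace.embedding p s‖ ^ 2 * e) 1 ∨ p.asIdeal ∣ 𝔞 ∧ (fun e : ℝ =>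
      ‖FinitePlace.embedding p (γ.val.det / c ^ 2)‖ * ‖(t : FinAdele F) p‖ =
        ‖(t' : FinAdele F) p‖ * max ‖FinitePlace.embedding p r * (t : FinAdele F) p‖
          ‖FinitePlace.embedding p s‖ ^ 2 * e) ‖(ϖ.unit p : p.adicCompletion F)‖⁻¹ := by
    intro p
    have h1 := congrArg (compFin p) h
    rw [map_mul] at h1
    have h2 : compFin p (aMat t') = aMat (Units.map (evalFin p : FinAdele F →* _) t') :=
      map_aMat _ _
    rw [h2] at h1
    have hγ : ∀ i j, (compFin p (rationalFin γ)).val i j = FinitePlace.embedding p (γ.val i j) :=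
      fun _ _ => rfl
    have hat : (compFin p (aMat t)).val = !![(t : FinAdele F) p, 0; 0, 1] := by
      rw [compFin, map_aMat, val_aMat]
      rfl
    have e0 : (compFin p (rationalFin γ * aMat t)).val 1 0 =
        FinitePlace.embedding p c * (FinitePlace.embedding p r * (t : FinAdele F) p) := by
      rw [map_mul, Units.val_mul, Matrix.mul_apply, Fin.sum_univ_two, hγ, hat, hr]
      simp [mul_assoc]
    have e1 : (compFin p (rationalFin γ * aMat t)).val 1 1 =
        FinitePlace.embedding p c * FinitePlace.embedding p s := by
      rw [map_mul, Units.val_mul, Matrix.mul_apply, Fin.sum_univ_two, hγ, hγ, hat, hs]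
      simp
    have e2 : (compFin p (rationalFin γ * aMat t)).val.det =
        FinitePlace.embedding p γ.val.det * (t : FinAdele F) p := by
      rw [map_mul, Units.val_mul, Matrix.det_mul, hat, Matrix.det_fin_two_of, RingHom.map_det]
      simp only [mul_one, mul_zero, sub_zero]
      rfl
    have hc' : ‖FinitePlace.embedding p c‖ ≠ 0 := by
      simpa using hc
    have := norm_det_of_mul_eq_aMat ϖ ((mem_finStar ϖ 𝔞).1 hk p) h1
    rw [e0, e1, e2, norm_mul, norm_mul, norm_mul (FinitePlace.embedding p c),
      ← mul_max_of_nonneg _ _ (norm_nonneg _), mul_pow] at this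
    have e3 : ((Units.map (evalFin p : FinAdele F →* p.adicCompletion F) t' :
      (p.adicCompletion F)ˣ) : p.adicCompletion F) = (t' : FinAdele F) p := rfl
    rw [e3] at this
    have e4 : ‖FinitePlace.embedding p (γ.val.det / c ^ 2)‖ =
        ‖FinitePlace.embedding p γ.val.det‖ / ‖FinitePlace.embedding p c‖ ^ 2 := by
      rw [map_div₀, map_pow, norm_div, norm_pow]
    simp only [e4]
    refine this.imp (fun h => ?_) (And.imp_right fun h => ?_)
    · rw [mul_one, div_mul_eq_mul_div, h]
      field_simp
    · rw [div_mul_eq_mul_div, h]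
      field_simp
  -- S collects the primes at which the relation without the extra factor |ϖ|⁻¹ fails; they all
  -- divide 𝔞.
  obtain ⟨S, hS⟩ : ∃ S : Set (HeightOneSpectrum (𝓞 F)), S = {p | ¬ (fun e : ℝ =>
      ‖FinitePlace.embedding p (γ.val.det / c ^ 2)‖ * ‖(t : FinAdele F) p‖ =
        ‖(t' : FinAdele F) p‖ * max ‖FinitePlace.embedding p r * (t : FinAdele F) p‖
          ‖FinitePlace.embedding p s‖ ^ 2 * e) 1} := ⟨_, rfl⟩
  have hSsub : S ⊆ {p : HeightOneSpectrum (𝓞 F) | p.asIdeal ∣ 𝔞} := by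
    intro p hp
    rw [hS] at hp
    exact ((key p).resolve_left hp).1
  have heq : ∀ p : HeightOneSpectrum (𝓞 F),
      ‖FinitePlace.embedding p (γ.val.det / c ^ 2)‖ * ‖(t : FinAdele F) p‖ =
        ‖(t' : FinAdele F) p‖ * max ‖FinitePlace.embedding p r * (t : FinAdele F) p‖
          ‖FinitePlace.embedding p s‖ ^ 2 *
          if p ∈ S then ‖(ϖ.unit p : p.adicCompletion F)‖⁻¹ else 1 := by
    intro p
    by_cases hp : p ∈ S
    · rw [if_pos hp]
      rw [hS] at hp
      exact ((key p).resolve_left hp).2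
    · rw [if_neg hp]
      rw [hS] at hp
      exact not_not.1 hp
  refine ⟨S, hSsub, ?_⟩
  have hf1 := hasFiniteMulSupport_norm_embedding hδ
  have hf2 := hasFiniteMulSupport_norm_idele t
  have hf3 := hasFiniteMulSupport_norm_idele t'
  have hf4 : (fun p : HeightOneSpectrum (𝓞 F) =>
      if p ∈ S then ‖(ϖ.unit p : p.adicCompletion F)‖⁻¹ else 1).HasFiniteMulSupport := by
    refine (finite_setOf_dvd h𝔞).subset fun p hp => hSsub ?_
    by_contra h
    exact hp (if_neg h)
  have hpos : ∀ p, (if p ∈ S then ‖(ϖ.unit p : p.adicCompletion F)‖⁻¹ else (1 : ℝ)) ≠ 0 := by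
    intro p
    split_ifs
    · exact inv_ne_zero (norm_ne_zero_iff.2 (ϖ.unit p).ne_zero)
    · exact one_ne_zero
  -- The local heights are 1 at almost all primes because the relation expresses them through
  -- factors that are.
  have hf5 : (fun p : HeightOneSpectrum (𝓞 F) =>
      max ‖FinitePlace.embedding p r * (t : FinAdele F) p‖
          ‖FinitePlace.embedding p s‖ ^ 2).HasFiniteMulSupport := by
    have : (fun p : HeightOneSpectrum (𝓞 F) =>
      max ‖FinitePlace.embedding p r * (t : FinAdele F) p‖
          ‖FinitePlace.embedding p s‖ ^ 2) = fun p =>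
        (‖FinitePlace.embedding p (γ.val.det / c ^ 2)‖ * ‖(t : FinAdele F) p‖) *
          (if p ∈ S then ‖(ϖ.unit p : p.adicCompletion F)‖⁻¹ else 1)⁻¹ *
            (‖(t' : FinAdele F) p‖)⁻¹ := by
      funext p
      rw [heq p, mul_inv_cancel_right₀ (hpos p), mul_comm ‖(t' : FinAdele F) p‖,
        mul_inv_cancel_right₀ (norm_ne_zero_iff.2 (idele_apply_ne_zero t' p))]
    rw [this]
    exact ((hf1.fun_mul hf2).fun_mul hf4.fun_inv).fun_mul hf3.fun_inv
  rw [finModulus, finModulus, finHeight, levelFactor, ← finprod_mul_distrib hf1 hf2,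
    ← finprod_mul_distrib hf3 hf5, ← finprod_mul_distrib (hf3.fun_mul hf5) hf4]
  exact finprod_congr heq

theorem norm_eq_of_mul_eq {γ : GL (Fin 2) F} {y y' : (InfiniteAdeleRing F)ˣ}
    {x x' : InfiniteAdeleRing F} {i j : Fin (NumberField.classNumber F)}
    {k : GL (Fin 2) (Adele F)} (hk : ∀ v, compInf v k ∈ ZKInf v)
    (h : rational γ * special θ y x i * k = special θ y' x' j) {c r s : F} (hc : c ≠ 0)
    (hr : γ.val 1 0 = c * r) (hs : γ.val 1 1 = c * s) :
    (∏ v : InfinitePlace F, ‖embArch v (γ.val.det / c ^ 2)‖ ^ v.mult) *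
      ‖(y : InfiniteAdeleRing F)‖ = ‖(y' : InfiniteAdeleRing F)‖ * archHeight y x r s := by
  rw [InfiniteAdeleRing.norm_def, InfiniteAdeleRing.norm_def, archHeight,
    ← Finset.prod_mul_distrib, ← Finset.prod_mul_distrib]
  refine Finset.prod_congr rfl fun v _ => ?_
  rw [← mul_pow, ← mul_pow]
  congr 1
  have h1 := congrArg (compInf v) h
  rw [map_mul, map_mul, compInf_special, compInf_special] at h1
  obtain ⟨b, hb⟩ : ∃ b, b = bMat (Units.map (evalArch v : InfiniteAdeleRing F →* v.Completion) y)
    (x v) := ⟨_, rfl⟩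
  rw [← hb] at h1
  have hbv : b.val = !![(y : InfiniteAdeleRing F) v, x v; 0, 1] := by
    rw [hb, val_bMat]
    rfl
  have hγ : ∀ i j, (compInf v (rational γ)).val i j = embArch v (γ.val i j) := fun _ _ => rfl
  have e0 : (compInf v (rational γ) * b).val 1 0 =
      embArch v c * (embArch v r * (y : InfiniteAdeleRing F) v) := by
    rw [Units.val_mul, Matrix.mul_apply, Fin.sum_univ_two, hγ, hbv, hr]
    simp [mul_assoc]
  have e1 : (compInf v (rational γ) * b).val 1 1 =
      embArch v c * (embArch v r * x v + embArch v s) := by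
    rw [Units.val_mul, Matrix.mul_apply, Fin.sum_univ_two, hγ, hγ, hbv, hr, hs]
    simp [mul_assoc, mul_add]
  have e2 : (compInf v (rational γ) * b).val.det =
      embArch v γ.val.det * (y : InfiniteAdeleRing F) v := by
    rw [Units.val_mul, Matrix.det_mul, hbv, Matrix.det_fin_two_of, RingHom.map_det]
    simp only [mul_one, mul_zero, sub_zero]
    rfl
  have hc' : ‖embArch v c‖ ≠ 0 := by simpa using hc
  have e3 := norm_det_of_mul_eq_bMat (hk v) h1
  rw [e0, e1, e2, norm_mul, norm_mul (embArch v c), norm_mul (embArch v c), mul_pow, mul_pow,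
    ← mul_add] at e3
  have e4 : ((Units.map (evalArch v : InfiniteAdeleRing F →* v.Completion) y' :
    v.Completionˣ) : v.Completion) = (y' : InfiniteAdeleRing F) v := rfl
  rw [e4] at e3
  rw [map_div₀, map_pow, norm_div, norm_pow, div_mul_eq_mul_div, e3]
  field_simp

/-- The ratio of the values of `|y|_∞` at two special matrices in the same double coset. -/
theorem norm_mul_finModulus_eq (h𝔞 : 𝔞 ≠ 0) {γ : GL (Fin 2) F} {y y' : (InfiniteAdeleRing F)ˣ}
    {x x' : InfiniteAdeleRing F} {i j : Fin (NumberField.classNumber F)}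
    {k : GL (Fin 2) (Adele F)} (hk : k ∈ KStar ϖ 𝔞)
    (h : rational γ * special θ y x i * k = special θ y' x' j) {c r s : F} (hc : c ≠ 0)
    (hr : γ.val 1 0 = c * r) (hs : γ.val 1 1 = c * s) :
    ∃ S ⊆ {p : HeightOneSpectrum (𝓞 F) | p.asIdeal ∣ 𝔞},
      ‖(y : InfiniteAdeleRing F)‖ * finModulus (θ i) = ‖(y' : InfiniteAdeleRing F)‖ *
        (finModulus (θ j) * (archHeight y x r s * finHeight (θ i) r s) * levelFactor ϖ S) := by
  rw [mem_KStar_iff] at hk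
  have h1 := congrArg finPart h
  rw [map_mul, map_mul, finPart_special, finPart_special, finPart_rational] at h1
  obtain ⟨S, hS, e1⟩ := finModulus_eq_of_mul_eq ϖ h𝔞 ((mem_finStar ϖ 𝔞).2 hk.2) h1 hc hr hs
  have e2 := norm_eq_of_mul_eq hk.1 h hc hr hs
  -- The product formula for det γ / c² removes γ from the relation except for its row (r, s).
  have e3 := prod_norm_embArch_mul_finprod
    (div_ne_zero (det_val_ne_zero γ) (pow_ne_zero 2 hc) : γ.val.det / c ^ 2 ≠ 0)
  refine ⟨S, hS, ?_⟩
  calc ‖(y : InfiniteAdeleRing F)‖ * finModulus (θ i)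
      = (∏ v : InfinitePlace F, ‖embArch v (γ.val.det / c ^ 2)‖ ^ v.mult) *
        (∏ᶠ p : HeightOneSpectrum (𝓞 F), ‖FinitePlace.embedding p (γ.val.det / c ^ 2)‖) *
        (‖(y : InfiniteAdeleRing F)‖ * finModulus (θ i)) := by rw [e3, one_mul]
    _ = _ := by
      rw [mul_mul_mul_comm, e1, e2]
      ring

/-- At each place max(|t|, 1) ≤ |x + t| + |x| + 1 ≤ M max(|y|, |x + t|) with M = 1 + (|x| + 1)/|y|,
finite since y_ν ≠ 0. The local constants are M⁻². -/
theorem exists_mul_le_archHeight (y : (InfiniteAdeleRing F)ˣ) (x : InfiniteAdeleRing F) :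
    ∃ C : ℝ, 0 < C ∧ ∀ t : F,
      C * (∏ v : InfinitePlace F, max ‖embArch v t‖ 1 ^ v.mult) ^ 2 ≤ archHeight y x 1 t := by
  have hy : ∀ v, 0 < ‖(y : InfiniteAdeleRing F) v‖ := fun v =>
    norm_pos_iff.2 ((y.isUnit.map (evalArch v)).ne_zero)
  have hloc : ∀ v : InfinitePlace F, ∃ C : ℝ, 0 < C ∧ ∀ t : F, C * max ‖embArch v t‖ 1 ^ 2 ≤
      ‖embArch v 1 * (y : InfiniteAdeleRing F) v‖ ^ 2 +
        ‖embArch v 1 * x v + embArch v t‖ ^ 2 := by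
    intro v
    have hM : 0 < 1 + (‖x v‖ + 1) / ‖(y : InfiniteAdeleRing F) v‖ := by
      have := hy v
      positivity
    refine ⟨((1 + (‖x v‖ + 1) / ‖(y : InfiniteAdeleRing F) v‖) ^ 2)⁻¹, by positivity,
      fun t => ?_⟩
    rw [map_one, one_mul, one_mul, inv_mul_le_iff₀ (by positivity)]
    set a := ‖(y : InfiniteAdeleRing F) v‖ with ha
    set b := ‖x v + embArch v t‖ with hb
    have ha0 : 0 < a := hy v
    have hb0 : 0 ≤ b := norm_nonneg _
    have h1 : ‖embArch v t‖ ≤ b + ‖x v‖ := by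
      have : embArch v t = (x v + embArch v t) - x v := by ring
      rw [this]
      exact norm_sub_le _ _
    have h2 : max ‖embArch v t‖ 1 ≤ b + (‖x v‖ + 1) :=
      max_le (by linarith) (by linarith [norm_nonneg (x v)])
    have h3 : b + (‖x v‖ + 1) ≤ (1 + (‖x v‖ + 1) / a) * max a b := by
      have h4 : (‖x v‖ + 1) = (‖x v‖ + 1) / a * a := by field_simp
      have h5 : 0 ≤ (‖x v‖ + 1) / a := by positivity
      calc b + (‖x v‖ + 1) = b + (‖x v‖ + 1) / a * a := by rw [← h4]
        _ ≤ max a b + (‖x v‖ + 1) / a * max a b := by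
          gcongr
          · exact le_max_right _ _
          · exact le_max_left _ _
        _ = _ := by ring
    have h6 : max a b ^ 2 ≤ a ^ 2 + b ^ 2 := by
      rcases max_cases a b with ⟨h, _⟩ | ⟨h, _⟩ <;> rw [h] <;> nlinarith
    calc max ‖embArch v t‖ 1 ^ 2 ≤ ((1 + (‖x v‖ + 1) / a) * max a b) ^ 2 := by
          gcongr
          exact h2.trans h3
      _ ≤ _ := by
          rw [mul_pow]
          gcongr
  choose C hC hle using hloc
  refine ⟨∏ v, C v ^ v.mult, Finset.prod_pos fun v _ => pow_pos (hC v) _, fun t => ?_⟩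
  rw [archHeight, ← Finset.prod_pow, ← Finset.prod_mul_distrib]
  refine Finset.prod_le_prod (fun v _ => ?_) fun v _ => ?_
  · have := hC v
    positivity
  · rw [← pow_mul, mul_comm v.mult 2, pow_mul, ← mul_pow]
    have := hC v
    exact pow_le_pow_left₀ (by positivity) (hle v t) _

/-- Since |t_𝔭| ≤ 1, each factor satisfies |t_𝔭| max(|s|, 1) ≤ max(|t_𝔭|, |s|). -/
theorem mul_le_finHeight {t : (FinAdele F)ˣ} (ht : ∀ p, Valued.v ((t : FinAdele F) p) ≤ 1)
    (s : F) : finModulus t ^ 2 *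
      (∏ᶠ p : HeightOneSpectrum (𝓞 F), max ‖FinitePlace.embedding p s‖ 1) ^ 2 ≤
        finHeight t 1 s := by
  have h1 := hasFiniteMulSupport_norm_idele t
  have hs : (fun p : HeightOneSpectrum (𝓞 F) =>
        max ‖FinitePlace.embedding p s‖ 1).HasFiniteMulSupport ∧
      (fun p : HeightOneSpectrum (𝓞 F) => max ‖FinitePlace.embedding p 1 * (t : FinAdele F) p‖
        ‖FinitePlace.embedding p s‖).HasFiniteMulSupport := by
    simp only [map_one, one_mul]
    by_cases h0 : s = 0
    · simp only [h0, map_zero, norm_zero, max_eq_right zero_le_one, norm_nonneg, max_eq_left]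
      exact ⟨Function.hasFiniteMulSupport_one, h1⟩
    · have h2 := hasFiniteMulSupport_norm_embedding h0
      exact ⟨h2.max Function.hasFiniteMulSupport_one, h1.max h2⟩
  rw [finModulus, finHeight, ← mul_pow, ← finprod_mul_distrib h1 hs.1, ← finprod_pow hs.2]
  refine pow_le_pow_left₀ (finprod_nonneg fun p => by positivity) ?_ 2
  refine finprod_le_finprod (h1.fun_mul hs.1) (fun p => by positivity) hs.2 fun p => ?_
  have h3 : ‖(t : FinAdele F) p‖ ≤ 1 := norm_le_one_iff_valued.2 (ht p)
  simp only [map_one, one_mul]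
  rw [mul_max_of_nonneg _ _ (norm_nonneg _), mul_one, max_comm]
  exact max_le_max le_rfl (mul_le_of_le_one_left (norm_nonneg _) h3)

theorem exists_mul_le_height (y : (InfiniteAdeleRing F)ˣ) (x : InfiniteAdeleRing F)
    {t : (FinAdele F)ˣ} (ht : ∀ p, Valued.v ((t : FinAdele F) p) ≤ 1) :
    ∃ C : ℝ, 0 < C ∧ ∀ s : F,
      C * Height.mulHeight₁ s ^ 2 ≤ archHeight y x 1 s * finHeight t 1 s := by
  obtain ⟨C, hC, h⟩ := exists_mul_le_archHeight y x
  refine ⟨C * finModulus t ^ 2, mul_pos hC (pow_pos (finModulus_pos t) 2), fun s => ?_⟩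
  rw [mulHeight₁_eq_finprod, mul_pow, mul_mul_mul_comm]
  exact mul_le_mul (h s) (mul_le_finHeight ht s) (by positivity)
    ((by positivity : (0 : ℝ) ≤ _).trans (h s))

theorem norm_unit_pos (y : (InfiniteAdeleRing F)ˣ) : 0 < ‖(y : InfiniteAdeleRing F)‖ := by
  rw [InfiniteAdeleRing.norm_def]
  exact Finset.prod_pos fun v _ =>
    pow_pos (norm_pos_iff.2 ((y.isUnit.map (evalArch v)).ne_zero)) _

/-- In a double coset only finitely many values of `|y|_∞` exceed a given one. -/
theorem finite_norm_special (hθ : IsClassRepresentatives θ) (h𝔞 : 𝔞 ≠ 0)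
    (y : (InfiniteAdeleRing F)ˣ) (x : InfiniteAdeleRing F)
    (i : Fin (NumberField.classNumber F)) :
    {N : ℝ | ‖(y : InfiniteAdeleRing F)‖ ≤ N ∧ ∃ (y' : (InfiniteAdeleRing F)ˣ)
      (x' : InfiniteAdeleRing F) (j : Fin (NumberField.classNumber F)) (γ : GL (Fin 2) F),
      ∃ k ∈ KStar ϖ 𝔞, special θ y' x' j = rational γ * special θ y x i * k ∧
        N = ‖(y' : InfiniteAdeleRing F)‖}.Finite := by
  obtain ⟨C, hC, hle⟩ := exists_mul_le_height y x (hθ.integral i)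
  -- If |y|_∞ ≤ |y'|_∞, the height is at most |θ_i|/|θ_j|, as the level factor is at least 1. The
  -- sum bounds this uniformly in j.
  set B : ℝ := ∑ j, finModulus (θ i) / finModulus (θ j) with hB
  have hT := NumberField.finite_setOfPred_mulHeight₁_le F (B / C)
  -- Up to scaling a lower row is (0, 1) or (1, t), and Northcott's theorem leaves finitely many t.
  -- The triple of j, S and the row determines |y'|_∞.
  set T : Set (F × F) := insert (0, 1) ((fun t => (1, t)) ''
    {t : F | Height.mulHeight₁ t ≤ B / C}) with hTdef
  have hTfin : T.Finite := (hT.image _).insert _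
  have hP : {S | S ⊆ {p : HeightOneSpectrum (𝓞 F) | p.asIdeal ∣ 𝔞}}.Finite :=
    (finite_setOf_dvd h𝔞).finite_subsets
  refine (((Set.finite_univ (α := Fin (NumberField.classNumber F))).prod
    (hP.prod hTfin)).image fun q => ‖(y : InfiniteAdeleRing F)‖ * finModulus (θ i) /
      (finModulus (θ q.1) * (archHeight y x q.2.2.1 q.2.2.2 *
        finHeight (θ i) q.2.2.1 q.2.2.2) * levelFactor ϖ q.2.1)).subset ?_
  rintro N ⟨hN, y', x', j, γ, k, hk, h, rfl⟩
  have hlhs : 0 < ‖(y : InfiniteAdeleRing F)‖ * finModulus (θ i) :=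
    mul_pos (norm_unit_pos y) (finModulus_pos _)
  have main : ∀ c r s : F, c ≠ 0 → γ.val 1 0 = c * r → γ.val 1 1 = c * s →
      ∃ S ⊆ {p : HeightOneSpectrum (𝓞 F) | p.asIdeal ∣ 𝔞},
        ‖(y' : InfiniteAdeleRing F)‖ = ‖(y : InfiniteAdeleRing F)‖ * finModulus (θ i) /
          (finModulus (θ j) * (archHeight y x r s * finHeight (θ i) r s) * levelFactor ϖ S) ∧
        archHeight y x r s * finHeight (θ i) r s ≤ B := by
    intro c r s hc hr hs
    obtain ⟨S, hS, e⟩ := norm_mul_finModulus_eq ϖ h𝔞 hk h.symm hc hr hs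
    refine ⟨S, hS, eq_div_of_mul_eq ?_ e.symm, ?_⟩
    · intro h0
      rw [h0, mul_zero] at e
      exact hlhs.ne' e
    · set W := archHeight y x r s * finHeight (θ i) r s
      have hW : 0 ≤ W := mul_nonneg
        (Finset.prod_nonneg fun v _ => by positivity) (finprod_nonneg fun p => by positivity)
      have h1 : W ≤ finModulus (θ i) / finModulus (θ j) := by
        rw [le_div_iff₀ (finModulus_pos _)]
        refine le_of_mul_le_mul_left ?_ (norm_unit_pos y)
        rw [e]
        have hj := finModulus_pos (θ j)
        refine mul_le_mul hN ?_ (by positivity) (norm_unit_pos y').le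
        rw [mul_comm W]
        exact le_mul_of_one_le_right (by positivity) (one_le_levelFactor ϖ S)
      refine h1.trans (Finset.single_le_sum (f := fun j => finModulus (θ i) / finModulus (θ j))
        (fun l _ => ?_) (Finset.mem_univ j))
      exact (div_pos (finModulus_pos _) (finModulus_pos _)).le
  by_cases hc : γ.val 1 0 = 0
  · have hd : γ.val 1 1 ≠ 0 := by
      intro hd
      refine det_val_ne_zero γ ?_
      rw [Matrix.det_fin_two, hc, hd]
      ring
    obtain ⟨S, hS, e, -⟩ := main (γ.val 1 1) 0 1 hd (by rw [hc, mul_zero]) (mul_one _).symm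
    exact ⟨(j, S, 0, 1), ⟨Set.mem_univ _, hS, Set.mem_insert _ _⟩, e.symm⟩
  · obtain ⟨S, hS, e, hb⟩ := main (γ.val 1 0) 1 (γ.val 1 1 / γ.val 1 0) hc (mul_one _).symm
      (by field_simp)
    refine ⟨(j, S, 1, γ.val 1 1 / γ.val 1 0), ⟨Set.mem_univ _, hS, Set.mem_insert_of_mem _
      ⟨_, ?_, rfl⟩⟩, e.symm⟩
    -- The comparison bounds the square of the height, which dominates the height because the latter
    -- is at least 1.
    have h1 := Height.one_le_mulHeight₁ (γ.val 1 1 / γ.val 1 0)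
    rw [Set.mem_ofPred_eq, le_div_iff₀ hC, mul_comm]
    refine le_trans ?_ ((hle _).trans hb)
    gcongr
    nlinarith

/-- Every double coset in `GL₂(F) \ GL₂(𝔸_F) / K^*` meets the generating domain. -/
theorem exists_eq_rational_mul_genDomain (hθ : IsClassRepresentatives θ) (h𝔞 : 𝔞 ≠ 0)
    (g : GL (Fin 2) (Adele F)) :
    ∃ γ y x i, ∃ k ∈ KStar ϖ 𝔞, special θ y x i ∈ genDomain ϖ θ 𝔞 ∧
      g = rational γ * special θ y x i * k := by
  obtain ⟨γ, y, x, i, k, hk, hg⟩ := exists_eq_rational_mul_special ϖ hθ h𝔞 g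
  -- A maximum among the values at least |y|_∞ is a maximum for the whole coset, since any larger
  -- competitor is again one of these values.
  obtain ⟨N, ⟨hN, y', x', j, γ', k', hk', h', rfl⟩, hmax⟩ := Set.exists_max_image _ id
    (finite_norm_special ϖ hθ h𝔞 y x i) ⟨‖(y : InfiniteAdeleRing F)‖, le_rfl, y, x, i, 1, 1,
      one_mem_KStar ϖ 𝔞, by simp, rfl⟩
  refine ⟨γ * γ'⁻¹, y', x', j, k'⁻¹ * k, mul_mem_KStar ϖ 𝔞 (inv_mem_KStar ϖ 𝔞 hk') hk,
    ⟨y', x', j, rfl, ?_⟩, ?_⟩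
  · rintro y'' x'' l ⟨γ'', k'', hk'', h''⟩
    by_contra! hlt
    refine hlt.not_ge (hmax _ ⟨hN.trans hlt.le, y'', x'', l, γ'' * γ', k' * k'',
      mul_mem_KStar ϖ 𝔞 hk' hk'', ?_, rfl⟩)
    rw [h'', h', map_mul]
    group
  · rw [h', hg, map_mul, map_inv]
    group

end Maximum

/-! ### Passing from square-free level to arbitrary level -/

section Level

/-- Used with t = ϖ and m = n₀, where n₁ = m + 1 and n_𝔭 = 2m + 1: moving past the shift turns (0 1;
ϖ 0) into the component of η, at the cost of a scalar. -/
theorem antiMat_mul_antiMat_one_mul_aMat {R : Type*} [CommRing R] (t : Rˣ) (m : ℕ) :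
    antiMat t * (antiMat 1 * aMat (t ^ (m + 1))) =
      zMat (t ^ m)⁻¹ * (antiMat 1 * aMat (t ^ (m + 1))) * antiMat (t ^ (2 * m + 1)) := by
  rw [zMat_inv, mul_assoc, eq_inv_mul_iff_mul_eq]
  apply Units.ext
  simp only [Units.val_mul, val_zMat, val_antiMat, val_aMat, Matrix.mul_fin_two,
    Units.val_pow_eq_pow_val]
  refine Matrix.ext fun i j => ?_
  fin_cases i <;> fin_cases j <;> simp <;> ring

variable {F : Type*} [Field F] [NumberField F] {p : HeightOneSpectrum (𝓞 F)}

theorem antiMat_one_mem_KFin : (antiMat 1 : GL (Fin 2) (p.adicCompletion F)) ∈ KFin p := by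
  refine mem_KFin_iff.2 ⟨fun i j => ?_, ?_⟩
  · fin_cases i <;> fin_cases j <;> simp
  · rw [val_antiMat, Matrix.det_fin_two_of]
    simp

theorem mem_K1Fin_zero {g : GL (Fin 2) (p.adicCompletion F)} (hg : g ∈ KFin p) :
    g ∈ K1Fin p 0 := by
  have h := (mem_KFin_iff.1 hg).1
  refine ⟨hg, ?_, by simpa using h 1 0⟩
  simpa using (Valuation.map_sub _ _ _).trans (max_le (h 0 0) (map_one Valued.v).le)

theorem one_mem_K1Fin (n : ℕ) : (1 : GL (Fin 2) (p.adicCompletion F)) ∈ K1Fin p n :=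
  ⟨one_mem _, by simp, by simp⟩

variable (ϖ : Uniformizers F) (𝔫 : Ideal (𝓞 F))

/-- The lower row is (u₁₁ϖ^{n₁}, u₁₀) with u₁₁ a unit. The one factor ϖ in u₁₀ improves the bound on
l from n₁ to n₁ - 1 = n₀. -/
theorem n1Inv_eq_ord0 {u : GL (Fin 2) (p.adicCompletion F)} (hu : u ∈ K0Fin p 1)
    (h : ord1 𝔫 p = ord0 𝔫 p + 1) :
    n1Inv ϖ 𝔫 p (u * (antiMat 1 * aMat (ϖ.unit p ^ ord1 𝔫 p))) = ord0 𝔫 p := by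
  have e0 : (u * (antiMat 1 * aMat (ϖ.unit p ^ ord1 𝔫 p))).val 1 0 =
      u.val 1 1 * (ϖ.unit p : p.adicCompletion F) ^ ord1 𝔫 p := by
    rw [Units.val_mul, Matrix.mul_apply, Fin.sum_univ_two, Units.val_mul, val_antiMat, val_aMat,
      Matrix.mul_fin_two]
    simp
  have e1 : (u * (antiMat 1 * aMat (ϖ.unit p ^ ord1 𝔫 p))).val 1 1 = u.val 1 0 := by
    rw [Units.val_mul, Matrix.mul_apply, Fin.sum_univ_two, Units.val_mul, val_antiMat, val_aMat,
      Matrix.mul_fin_two]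
    simp
  have h11 := (valued_diag_of_mem_K0Fin le_rfl hu).2
  refine if_pos (lInv_le ϖ (m := ord0 𝔫 p) (Nat.sub_le _ _) ?_ ?_)
  · rw [e0]
    refine mul_ne_zero (fun h0 => ?_) (pow_ne_zero _ (ϖ.unit p).ne_zero)
    rw [h0, map_zero] at h11
    exact zero_ne_one h11
  · rw [e0, e1, map_mul, h11, one_mul, map_pow, valued_unit, ← WithZero.exp_nsmul,
      ← WithZero.exp_add, h]
    convert hu.2 using 2
    simp

open Classical in
/-- The local component at `𝔭` of the matrix that conjugates `K^*` to level `𝔫`. -/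
noncomputable def levelShift (p : HeightOneSpectrum (𝓞 F)) : GL (Fin 2) (p.adicCompletion F) :=
  if p.asIdeal ∣ 𝔫 then antiMat 1 * aMat (ϖ.unit p ^ ord1 𝔫 p) else 1

/-- The conditions on the component at `𝔭` of an element of `𝒥_𝔫`. -/
def IsLocalJ (p : HeightOneSpectrum (𝓞 F)) (j : GL (Fin 2) (p.adicCompletion F)) : Prop :=
  (p.asIdeal ∣ 𝔫 → (∃ k ∈ KFin p, j = k * aMat (ϖ.unit p ^ ord1 𝔫 p)) ∧
    n1Inv ϖ 𝔫 p j = ord0 𝔫 p) ∧ (¬ p.asIdeal ∣ 𝔫 → j = 1)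

-- `P` records whether the coset of (0 1; ϖ 0) occurs, and will define 𝔏. The clause giving z = 1
-- ensures that the local scalars assemble to an idele.
open Classical in
theorem exists_local_decomposition (h𝔫 : 𝔫 ≠ 0) {κ : GL (Fin 2) (p.adicCompletion F)}
    (hκ : κ ∈ localStar ϖ (sqfreePart 𝔫) p) :
    ∃ (z : (p.adicCompletion F)ˣ) (j u : GL (Fin 2) (p.adicCompletion F)) (P : Prop),
      IsLocalJ ϖ 𝔫 p j ∧ u ∈ K1Fin p (ordAt 𝔫 p) ∧ (P → p.asIdeal ∣ sqfreePart 𝔫) ∧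
      (¬ p.asIdeal ∣ 𝔫 → κ ∈ KFin p → z = 1) ∧
      κ * levelShift ϖ 𝔫 p =
        zMat z * j * (if P then antiMat (ϖ.unit p ^ ordAt 𝔫 p) else 1) * u := by
  by_cases hn : p.asIdeal ∣ 𝔫
  · have hsh : levelShift ϖ 𝔫 p = antiMat 1 * aMat (ϖ.unit p ^ ord1 𝔫 p) := if_pos hn
    rw [hsh]
    have hJ : ∀ u ∈ KFin p, n1Inv ϖ 𝔫 p (u * (antiMat 1 * aMat (ϖ.unit p ^ ord1 𝔫 p))) =
        ord0 𝔫 p → IsLocalJ ϖ 𝔫 p (u * (antiMat 1 * aMat (ϖ.unit p ^ ord1 𝔫 p))) :=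
      fun u hu h => ⟨fun _ => ⟨⟨u * antiMat 1, mul_mem hu antiMat_one_mem_KFin,
        (mul_assoc _ _ _).symm⟩, h⟩, fun h => absurd hn h⟩
    unfold localStar at hκ
    split_ifs at hκ with h2
    · have hord := (dvd_sqfreePart_iff 𝔫 p).1 h2
      obtain ⟨z, u, hu, rfl | rfl⟩ := exists_of_mem_closure ϖ hκ
      · refine ⟨z, _, 1, False, hJ u hu.1 (n1Inv_eq_ord0 ϖ 𝔫 hu hord), one_mem_K1Fin _, False.elim,
          fun h => absurd hn h, ?_⟩
        rw [if_neg not_false, mul_one, mul_one, mul_assoc]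
      · refine ⟨z * (ϖ.unit p ^ ord0 𝔫 p)⁻¹, _, 1, True, hJ u hu.1 (n1Inv_eq_ord0 ϖ 𝔫 hu hord),
          one_mem_K1Fin _, fun _ => h2, fun h => absurd hn h, ?_⟩
        have hn' : ordAt 𝔫 p = 2 * ord0 𝔫 p + 1 := by
          unfold ord0 ord1 at *
          omega
        rw [if_pos trivial, mul_one, hord, hn', mul_assoc (zMat z * u),
          antiMat_mul_antiMat_one_mul_aMat, mul_assoc (zMat _) _ (antiMat _), zMat_mul_mul]
        simp only [mul_assoc]
    · obtain ⟨z, u, hu, rfl⟩ := hκ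
      refine ⟨z, _, 1, False, hJ u hu ?_, one_mem_K1Fin _, False.elim, fun h => absurd hn h, ?_⟩
      · unfold n1Inv
        -- With n₁ = n₀ the two values of the invariant coincide, whatever l is.
        rw [ord1_eq_ord0_of_not_dvd h2, ite_self]
      · rw [if_neg not_false, mul_one, mul_one, mul_assoc]
  · have hsh : levelShift ϖ 𝔫 p = 1 := if_neg hn
    have hord : ordAt 𝔫 p = 0 := not_not.1 (mt (dvd_iff_ordAt_ne_zero h𝔫 p).2 hn)
    have h2 : ¬ p.asIdeal ∣ sqfreePart 𝔫 := by
      rw [dvd_sqfreePart_iff]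
      unfold ord0 ord1
      omega
    have hJ : IsLocalJ ϖ 𝔫 p 1 := ⟨fun h => absurd h hn, fun _ => rfl⟩
    rw [hsh, hord]
    by_cases hK : κ ∈ KFin p
    · exact ⟨1, 1, κ, False, hJ, mem_K1Fin_zero hK, False.elim, fun _ _ => rfl, by
        simp [zMat_one]⟩
    · rw [localStar, if_neg h2] at hκ
      obtain ⟨z, u, hu, rfl⟩ := hκ
      exact ⟨z, 1, u, False, hJ, mem_K1Fin_zero hu, False.elim, fun _ h => absurd h hK, by simp⟩

/-- The finite idele with given components, almost all of which are `1`. -/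
def ideleOfLocal (z : ∀ p : HeightOneSpectrum (𝓞 F), (p.adicCompletion F)ˣ)
    (hz : ∀ᶠ p in Filter.cofinite, z p = 1) : (FinAdele F)ˣ where
  val := ⟨fun p => (z p).val, hz.mono fun p hp => by
    change (z p).val ∈ p.adicCompletionIntegers F
    rw [hp]
    exact one_mem _⟩
  inv := ⟨fun p => (z p).inv, hz.mono fun p hp => by
    change (z p).inv ∈ p.adicCompletionIntegers F
    rw [hp]
    exact one_mem _⟩
  val_inv := FiniteAdeleRing.ext _ fun p => (z p).val_inv
  inv_val := FiniteAdeleRing.ext _ fun p => (z p).inv_val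

/-- The idele with given archimedean and finite parts. -/
def adeleUnit (y : (InfiniteAdeleRing F)ˣ) (t : (FinAdele F)ˣ) : (Adele F)ˣ where
  val := (y.val, t.val)
  inv := (y.inv, t.inv)
  val_inv := Prod.ext y.val_inv t.val_inv
  inv_val := Prod.ext y.inv_val t.inv_val

theorem compInf_zMat_adeleUnit (y : ∀ v : InfinitePlace F, v.Completionˣ) (t : (FinAdele F)ˣ)
    (v : InfinitePlace F) : compInf v (zMat (adeleUnit (archUnit y) t)) = zMat (y v) := by
  rw [compInf, map_zMat]
  congr 1

theorem compFin_zMat_adeleUnit (y : (InfiniteAdeleRing F)ˣ)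
    (z : ∀ p : HeightOneSpectrum (𝓞 F), (p.adicCompletion F)ˣ)
    (hz : ∀ᶠ p in Filter.cofinite, z p = 1) (p : HeightOneSpectrum (𝓞 F)) :
    compFin p (finPart (zMat (adeleUnit y (ideleOfLocal z hz)))) = zMat (z p) := by
  rw [compFin, finPart, map_zMat, map_zMat]
  congr 1

theorem compFin_finOfLocal (g : ∀ p : HeightOneSpectrum (𝓞 F), GL (Fin 2) (p.adicCompletion F))
    (h : ∀ᶠ p in Filter.cofinite, g p ∈ KFin p) (p : HeightOneSpectrum (𝓞 F)) :
    compFin p (finOfLocal g h) = g p := Units.ext rfl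

theorem eventually_compFin_mem_KFin (g : GL (Fin 2) (FinAdele F)) :
    ∀ᶠ p in Filter.cofinite, compFin p g ∈ KFin p := by
  have h1 : ∀ᶠ p in Filter.cofinite, ∀ ij : Fin 2 × Fin 2,
      Valued.v ((compFin p g).val ij.1 ij.2) ≤ 1 :=
    Filter.eventually_all.2 fun ij => (g.val ij.1 ij.2).2
  have h2 : ∀ᶠ p in Filter.cofinite,
      Valued.v ((Matrix.GeneralLinearGroup.det g : FinAdele F) p) = 1 :=
    FiniteAdeleRing.unitsEquiv_finite_valued_eq_one (Matrix.GeneralLinearGroup.det g)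
  filter_upwards [h1, h2] with p hp1 hp2
  refine mem_KFin_iff.2 ⟨fun i j => hp1 (i, j), ?_⟩
  rw [← hp2]
  congr 1

variable {θ : Fin (NumberField.classNumber F) → (FinAdele F)ˣ}

theorem exists_decomposition (hθ : IsClassRepresentatives θ) (h𝔫 : 𝔫 ≠ 0)
    (g : GL (Fin 2) (Adele F)) : ∃ 𝔏 : Ideal (𝓞 F), 𝔏 ∣ sqfreePart 𝔫 ∧
      ∃ i : Fin (NumberField.classNumber F), ∃ (z : (Adele F)ˣ) (γ : GL (Fin 2) F),
        ∃ j ∈ calJ ϖ 𝔫 𝔫, ∃ b ∈ calF ϖ θ (sqfreePart 𝔫), ∃ k ∈ K1 𝔫,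
          g = zMat z * rational γ * glPair b (aMat (θ i) * j) * eta ϖ 𝔫 𝔏 * k := by
  classical
  have hndvd : ∀ᶠ p : HeightOneSpectrum (𝓞 F) in Filter.cofinite, ¬ p.asIdeal ∣ 𝔫 := by
    rw [Filter.eventually_cofinite]
    simpa using finite_setOf_dvd h𝔫
  have hshift : ∀ᶠ p in Filter.cofinite, levelShift ϖ 𝔫 p ∈ KFin p :=
    hndvd.mono fun p hp => by rw [levelShift, if_neg hp]; exact one_mem _
  -- The generating domain is applied to the translate of g by the inverse shift, so that the shift
  -- ends up to the right of κ.
  obtain ⟨γ, y, x, i, κ, hκ, hdom, hg⟩ := exists_eq_rational_mul_genDomain ϖ hθ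
    (sqfreePart_ne_zero 𝔫) (g * (glPair 1 (finOfLocal _ hshift))⁻¹)
  rw [mul_inv_eq_iff_eq_mul] at hg
  obtain ⟨hκ1, hκ2⟩ := (mem_KStar_iff ϖ _).1 hκ
  choose zi ki hki hzki using hκ1
  choose zf j u P hj hu hP hzf hdec using fun p => exists_local_decomposition ϖ 𝔫 h𝔫 (hκ2 p)
  obtain ⟨𝔏, h𝔏, h𝔏P⟩ := exists_dvd_sqfreePart 𝔫 {p | P p} hP
  have hz1 : ∀ᶠ p in Filter.cofinite, zf p = 1 := by
    filter_upwards [hndvd, eventually_compFin_mem_KFin (finPart κ)] with p hp hp'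
    exact hzf p hp hp'
  have hjK : ∀ᶠ p in Filter.cofinite, j p ∈ KFin p :=
    hndvd.mono fun p hp => by rw [(hj p).2 hp]; exact one_mem _
  obtain ⟨z, hz⟩ : ∃ z, z = adeleUnit (archUnit zi) (ideleOfLocal zf hz1) := ⟨_, rfl⟩
  -- Taking k to be whatever remains makes the equation automatic; only its membership in K₁(𝔫)
  -- needs checking, place by place.
  refine ⟨𝔏, h𝔏, i, z, γ, finOfLocal j hjK, ⟨⟨fun p hp => ?_, fun p hp => ?_⟩, fun p hp => ?_⟩,
    bMat y x, ⟨y, x, rfl, i, hdom⟩, (zMat z * rational γ *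
      glPair (bMat y x) (aMat (θ i) * finOfLocal j hjK) * eta ϖ 𝔫 𝔏)⁻¹ * g,
    ⟨fun v => ?_, fun p => ?_⟩, (mul_inv_cancel_left _ _).symm⟩
  · rw [compFin_finOfLocal]
    exact ((hj p).1 hp).1
  · rw [compFin_finOfLocal]
    exact (hj p).2 hp
  · rw [compFin_finOfLocal]
    exact ((hj p).1 hp).2
  · have h1 : compInf v (glPair 1 (finOfLocal _ hshift)) = 1 := by
      rw [compInf_glPair, map_one]
    have h2 : compInf v (eta ϖ 𝔫 𝔏) = 1 := by
      rw [eta, compInf_glPair, map_one]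
    have h3 : compInf v (special θ y x i) =
      compInf v (glPair (bMat y x) (aMat (θ i) * finOfLocal j hjK)) := rfl
    rw [hg]
    simp only [map_mul, map_inv]
    rw [h1, h2, h3, mul_one, mul_one, hz, compInf_zMat_adeleUnit, hzki]
    convert hki v using 1
    rw [← mul_assoc _ (zMat (zi v)), ← zMat_comm, ← mul_assoc (zMat (zi v)),
      inv_mul_cancel_left]
  · have h2 : compFin p (finPart (eta ϖ 𝔫 𝔏)) =
        if P p then antiMat (ϖ.unit p ^ ordAt 𝔫 p) else 1 := by
      rw [eta, finPart_glPair, compFin_finOfLocal, etaLocal]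
      exact if_congr (h𝔏P p) rfl rfl
    rw [hg]
    simp only [map_mul, map_inv, finPart_special, finPart_glPair, compFin_finOfLocal]
    rw [h2, hz, compFin_zMat_adeleUnit, mul_assoc _ (compFin p (finPart κ)), hdec p]
    convert hu p using 1
    rw [inv_mul_eq_iff_eq_mul]
    simp only [← mul_assoc]
    rw [← zMat_comm]
    simp only [mul_assoc]

/-- The bound for the supremum of a form of level `𝔫`. -/
theorem iSup_enorm_le (hθ : IsClassRepresentatives θ) (h𝔫 : 𝔫 ≠ 0)
    {ω : (Adele F)ˣ →* Circle} (χ : Ideal (𝓞 F) → (Adele F)ˣ →* Circle)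
    {φ : GL (Fin 2) (Adele F) → ℂ} (hφ : IsFormOfLevel φ ω 𝔫) :
    (⨆ g : GL (Fin 2) (Adele F), ‖φ g‖ₑ) ≤
      (⨆ (𝔏 : Ideal (𝓞 F)) (_ : 𝔏 ∣ sqfreePart 𝔫) (i : Fin (NumberField.classNumber F))
        (j ∈ calJ ϖ 𝔫 𝔫) (b ∈ calF ϖ θ (sqfreePart 𝔫)),
        ‖twist ϖ 𝔫 𝔏 ω (χ 𝔏) φ (glPair b (aMat (θ i) * j))‖ₑ) := by
  refine iSup_le fun g => ?_
  obtain ⟨𝔏, h𝔏, i, z, γ, j, hj, b, hb, k, hk, rfl⟩ := exists_decomposition ϖ 𝔫 hθ h𝔫 g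
  -- Both the central character and the twisting factor take values on the unit circle and disappear
  -- from absolute values.
  have henorm : ∀ c : Circle, ‖(c : ℂ)‖ₑ = 1 := fun c => by
    rw [← ofReal_norm, Circle.norm_coe, ENNReal.ofReal_one]
  have h : ‖φ (zMat z * rational γ * glPair b (aMat (θ i) * j) * eta ϖ 𝔫 𝔏 * k)‖ₑ =
      ‖twist ϖ 𝔫 𝔏 ω (χ 𝔏) φ (glPair b (aMat (θ i) * j))‖ₑ := by
    rw [hφ.right_invariant _ k hk, mul_assoc, mul_assoc, hφ.central, hφ.left_invariant, twist,
      enorm_mul, enorm_mul, henorm, henorm]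
  rw [h]
  exact le_iSup₂_of_le 𝔏 h𝔏 (le_iSup_of_le i (le_iSup₂_of_le j hj (le_iSup₂_of_le b hb le_rfl)))

end Level

end AdelicGL2

theorem mainTheorem6 {F : Type*} [Field F] [NumberField F] (ϖ : Uniformizers F)
    (θ : Fin (NumberField.classNumber F) → (FinAdele F)ˣ) (hθ : IsClassRepresentatives θ)
    (𝔫 : Ideal (𝓞 F)) (h𝔫 : 𝔫 ≠ 0) :
    (∀ g : GL (Fin 2) (Adele F), ∃ 𝔏 : Ideal (𝓞 F), 𝔏 ∣ sqfreePart 𝔫 ∧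
      ∃ i : Fin (NumberField.classNumber F), ∃ (z : (Adele F)ˣ) (γ : GL (Fin 2) F),
        ∃ j ∈ calJ ϖ 𝔫 𝔫, ∃ b ∈ calF ϖ θ (sqfreePart 𝔫), ∃ k ∈ K1 𝔫,
          g = zMat z * rational γ * glPair b (aMat (θ i) * j) * eta ϖ 𝔫 𝔏 * k) ∧
    (∀ (ω : (Adele F)ˣ →* Circle) (χ : Ideal (𝓞 F) → (Adele F)ˣ →* Circle)
      (φ : GL (Fin 2) (Adele F) → ℂ),
      (∀ 𝔏, 𝔏 ∣ sqfreePart 𝔫 → IsTwistCharacter ω 𝔏 (χ 𝔏)) → IsFormOfLevel φ ω 𝔫 →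
      (⨆ g : GL (Fin 2) (Adele F), ‖φ g‖ₑ) ≤
        (⨆ (𝔏 : Ideal (𝓞 F)) (_ : 𝔏 ∣ sqfreePart 𝔫) (i : Fin (NumberField.classNumber F))
          (j ∈ calJ ϖ 𝔫 𝔫) (b ∈ calF ϖ θ (sqfreePart 𝔫)),
          ‖twist ϖ 𝔫 𝔏 ω (χ 𝔏) φ (glPair b (aMat (θ i) * j))‖ₑ)) := by
  exact ⟨exists_decomposition ϖ 𝔫 hθ h𝔫, fun _ χ _ _ hφ => iSup_enorm_le ϖ 𝔫 hθ h𝔫 χ hφ⟩
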